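/- Let $d\ge 2$ and $\lambda\in[0,1)$. In $\mathbb R^d$ with the Euclidean norm and standard basis $\mathbf e_1,\dots,\mathbf e_d$, let $$S=\{x:\|x\|=1\},\quad L_\lambda=\{t\mathbf e_1+\lambda\mathbf e_2: t\in\mathbb R\},\quad H_+=\{x:\langle x,\mathbf e_1\rangle>0\},\quad \Delta=\{x:\langle x,\mathbf e_1\rangle\in(0,1]\},$$ and $x^*=\sqrt{1-\lambda^2}\,\mathbf e_1+\lambda\mathbf e_2$. For $A,B\subseteq\mathbb R^d$ let $P_A(x)=\{y\in A:\|x-y\|=\inf_{z\in A}\|x-z\|\}$, $R_A=2P_A-I$, and let $T_{A,B}=\frac12(I+R_BR_A)$ be the (set-valued) Douglas–Rachford operator. Define Benoist's function $F:\Delta\to\mathbb R$ by $$F(x)=\tfrac12\|x-\lambda\mathbf e_2\|^2-\lambda\log\!\Big(1+\sqrt{1-\langle x,\mathbf e_1\rangle^2}\Big)+\lambda\sqrt{1-\langle x,\mathbf e_1\rangle^2}+(\lambda-1)\log\langle x,\mathbf e_1\rangle .$$ Definitions. Let $D\subseteq\mathbb R^d$, let $T$ be a set-valued map from $D$ to subsets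 of $D$, and let $\omega_1,\omega_2:D\to\mathbb R_+=[0,\infty)$ be continuous. * $\mathcal S(x,T)$ is the set of sequences $\phi=(\phi(n))_{n\ge0}$ with $\phi(0)=x$ and $\phi(n+1)\in T(\phi(n))$ for all $n\ge 0$. For $\sigma:D\to\mathbb R_+$ with $B[x,\sigma(x)]\subseteq D$ for all $x\in D$ (closed balls), put $T_\sigma x=\bigcup_{y\in T(B[x,\sigma(x)])}B[y,\sigma(y)]$. Let $\mathcal A=\{x\in D:\sup_{n}\sup_{\phi\in\mathcal S(x,T)}\omega_1(\phi(n))=0\}$, and let $\mathcal A_\sigma$ be the same set with $T_\sigma$ in place of $T$. * $\alpha:\mathbb R_+\to\mathbb R_+$ is of class $\mathcal K_\infty$ if it is continuous, strictly increasing, $\alpha(0)=0$ and $\alpha(t)\to\infty$ as $t\to\infty$; it is positive definite if $\alpha(t)=0\iff t=0$. $\beta:\mathbb R_+\times\mathbb R_+\to\mathbb R_+$ is of class $\mathcal{KL}$ if for every $t$ the function $\beta(\cdot,t)$ is continuous and strictly increasing with $\beta(0,t)=0$, and for every $s$ the function $\beta(s,\cdot)$ is non-increasing and tends to $0$ at infinity.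 * The inclusion $x_{n+1}\in Tx_n$ is $\mathcal{KL}$-stable on $D$ with respect to $(\omega_1,\omega_2)$ if for some $\beta$ of class $\mathcal{KL}$ one has $\omega_1(\phi(n))\le\beta(\omega_2(x),n)$ for all $x\in D$, $\phi\in\mathcal S(x,T)$, $n\ge0$. It is robustly $\mathcal{KL}$-stable on $D$ with respect to $(\omega_1,\omega_2)$ if there is a continuous $\sigma:D\to\mathbb R_+$ such that $B[x,\sigma(x)]\subseteq D$ for all $x\in D$, $\sigma>0$ on $D\setminus\mathcal A$, $\mathcal A_\sigma=\mathcal A$, and $x_{n+1}\in T_\sigma x_n$ is $\mathcal{KL}$-stable on $D$ with respect to $(\omega_1,\omega_2)$. * $V:D\to\mathbb R_+$ is a Lyapunov function on $D$ for $x_{n+1}\in Tx_n$ with respect to $(\omega_1,\omega_2)$ if there are $\alpha_1,\alpha_2$ of class $\mathcal K_\infty$ and a continuous positive definite $\alpha:\mathbb R_+\to\mathbb R_+$ such that for all $x\in D$: $\alpha_1(\omega_1(x))\le V(x)\le\alpha_2(\omega_2(x))$; $\sup_{y\in Tx}V(y)\le V(x)-\alpha(V(x))$; and $V(x)=0\iff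 x\in\mathcal A$. Theorem 2.6. For every $x\in H_+$ the set $T_{S,L_\lambda}x$ consists of a single point, again denoted $T_{S,L_\lambda}x$, and this point lies in $\Delta\subseteq H_+$. The function $$V(x)=F(T_{S,L_\lambda}x)-F(x^*),\qquad x\in H_+,$$ is non-negative and continuous on $H_+$, and it is a Lyapunov function on $H_+$ for the Douglas–Rachford iteration $x_{n+1}=T_{S,L_\lambda}x_n$, $x_0\in H_+$, with respect to $\omega_1=\omega_2=V$. Moreover, this iteration is robustly $\mathcal{KL}$-stable on $H_+$ with respect to $\omega_1=\omega_2=V$. -/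

import Mathlib

open scoped NNReal ENNReal

noncomputable section

namespace DouglasRachford

/-- `ℝ^d` with the Euclidean norm. -/
abbrev E (d : ℕ) : Type := EuclideanSpace ℝ (Fin d)

/-! ### Projections, reflections and the (set-valued) Douglas-Rachford operator -/

/-- The set-valued projection `P_A x = {y ∈ A | ‖x - y‖ = inf_{z ∈ A} ‖x - z‖}`. -/
def proj {d : ℕ} (A : Set (E d)) (x : E d) : Set (E d) :=
  {y | y ∈ A ∧ ‖x - y‖ = ⨅ z : A, ‖x - (z : E d)‖}

/-- The set-valued reflection `R_A = 2 P_A - I`. -/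
def refl {d : ℕ} (A : Set (E d)) (x : E d) : Set (E d) :=
  {z | ∃ p ∈ proj A x, z = (2 : ℝ) • p - x}

/-- The set-valued Douglas-Rachford operator `T_{A,B} = (I + R_B R_A) / 2`. -/
def drOperator {d : ℕ} (A B : Set (E d)) (x : E d) : Set (E d) :=
  {w | ∃ y ∈ refl A x, ∃ z ∈ refl B y, w = (2⁻¹ : ℝ) • (x + z)}

/-! ### Difference inclusions and their stability -/

/-- Solutions of the difference inclusion `x_{n+1} ∈ T x_n`, `x_0 = x`. -/
def solutions {d : ℕ} (T : E d → Set (E d)) (x : E d) : Set (ℕ → E d) :=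
  {φ | φ 0 = x ∧ ∀ n, φ (n + 1) ∈ T (φ n)}

/-- The `σ`-perturbation `T_σ x = ⋃_{y ∈ T (B[x, σ x])} B[y, σ y]`. -/
def perturb {d : ℕ} (T : E d → Set (E d)) (σ : E d → ℝ≥0) (x : E d) : Set (E d) :=
  ⋃ x' ∈ Metric.closedBall x (σ x), ⋃ y ∈ T x', Metric.closedBall y (σ y)

/-- The set of the points of `D` from which `ω` vanishes along all solutions of
`x_{n+1} ∈ T x_n` (suprema are taken in `[0, ∞]`). -/
def zeroSet {d : ℕ} (D : Set (E d)) (T : E d → Set (E d)) (ω : E d → ℝ≥0) : Set (E d) :=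
  {x | x ∈ D ∧ (⨆ n : ℕ, ⨆ φ ∈ solutions T x, (ω (φ n) : ℝ≥0∞)) = 0}

/-- Class `𝒦`. -/
structure ClassK (α : ℝ≥0 → ℝ≥0) : Prop where
  continuous : Continuous α
  strictMono : StrictMono α
  map_zero : α 0 = 0

/-- Class `𝒦_∞`. -/
structure ClassKInfty (α : ℝ≥0 → ℝ≥0) : Prop extends ClassK α where
  tendsto : Filter.Tendsto α Filter.atTop Filter.atTop

/-- Class `𝒦ℒ`. -/
structure ClassKL (β : ℝ≥0 → ℝ≥0 → ℝ≥0) : Prop where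
  continuous : ∀ t, Continuous fun s => β s t
  strictMono : ∀ t, StrictMono fun s => β s t
  map_zero : ∀ t, β 0 t = 0
  antitone : ∀ s, Antitone (β s)
  tendsto : ∀ s, Filter.Tendsto (β s) Filter.atTop (nhds 0)

/-- `x_{n+1} ∈ T x_n` is `𝒦ℒ`-stable on `D` with respect to `(ω₁, ω₂)`. -/
def IsKLStable {d : ℕ} (D : Set (E d)) (T : E d → Set (E d)) (ω₁ ω₂ : E d → ℝ≥0) : Prop :=
  ∃ β : ℝ≥0 → ℝ≥0 → ℝ≥0, ClassKL β ∧
    ∀ x ∈ D, ∀ φ ∈ solutions T x, ∀ n : ℕ, ω₁ (φ n) ≤ β (ω₂ x) (n : ℝ≥0)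

/-- `x_{n+1} ∈ T x_n` is robustly `𝒦ℒ`-stable on `D` with respect to `(ω₁, ω₂)`. -/
def IsRobustlyKLStable {d : ℕ} (D : Set (E d)) (T : E d → Set (E d))
    (ω₁ ω₂ : E d → ℝ≥0) : Prop :=
  ∃ σ : E d → ℝ≥0, ContinuousOn σ D ∧
    (∀ x ∈ D, Metric.closedBall x (σ x : ℝ) ⊆ D) ∧
    (∀ x ∈ D \ zeroSet D T ω₁, 0 < σ x) ∧
    zeroSet D (perturb T σ) ω₁ = zeroSet D T ω₁ ∧
    IsKLStable D (perturb T σ) ω₁ ω₂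

/-- `V` is a Lyapunov function on `D` for `x_{n+1} ∈ T x_n` with respect to `(ω₁, ω₂)`.
The subtraction in `decrease` is that of the real numbers. -/
structure IsLyapunov {d : ℕ} (D : Set (E d)) (T : E d → Set (E d))
    (ω₁ ω₂ V : E d → ℝ≥0) : Prop where
  bounds : ∃ α₁ α₂ : ℝ≥0 → ℝ≥0, ClassKInfty α₁ ∧ ClassKInfty α₂ ∧
    ∀ x ∈ D, α₁ (ω₁ x) ≤ V x ∧ V x ≤ α₂ (ω₂ x)
  decrease : ∃ α : ℝ≥0 → ℝ≥0, Continuous α ∧ (∀ t, α t = 0 ↔ t = 0) ∧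
    ∀ x ∈ D, ∀ y ∈ T x, (V y : ℝ) ≤ (V x : ℝ) - (α (V x) : ℝ)
  eq_zero_iff : ∀ x ∈ D, V x = 0 ↔ x ∈ zeroSet D T ω₁

/-! ### The sphere, the line, and the function `F` -/

/-- The first standard basis vector. -/
def e₁ {d : ℕ} (hd : 2 ≤ d) : E d := EuclideanSpace.single ⟨0, by omega⟩ 1

/-- The second standard basis vector. -/
def e₂ {d : ℕ} (hd : 2 ≤ d) : E d := EuclideanSpace.single ⟨1, by omega⟩ 1

/-- The unit sphere. -/
def sphere (d : ℕ) : Set (E d) := {x | ‖x‖ = 1}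

/-- The line `L_λ = {t e₁ + λ e₂ | t ∈ ℝ}`. -/
def line {d : ℕ} (hd : 2 ≤ d) (lam : ℝ) : Set (E d) :=
  {x | ∃ t : ℝ, x = t • e₁ hd + lam • e₂ hd}

/-- The open half-space `H_+`. -/
def halfSpace {d : ℕ} (hd : 2 ≤ d) : Set (E d) := {x | 0 < inner ℝ x (e₁ hd)}

/-- The slab `Δ = {x | ⟨x, e₁⟩ ∈ (0, 1]}`, the domain of `F`. -/
def slab {d : ℕ} (hd : 2 ≤ d) : Set (E d) := {x | inner ℝ x (e₁ hd) ∈ Set.Ioc (0 : ℝ) 1}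

/-- The intersection point `x* = √(1 - λ²) e₁ + λ e₂`. -/
def xStar {d : ℕ} (hd : 2 ≤ d) (lam : ℝ) : E d :=
  √(1 - lam ^ 2) • e₁ hd + lam • e₂ hd

/-- Benoist's function `F`; only its values on `slab` matter. -/
def F {d : ℕ} (hd : 2 ≤ d) (lam : ℝ) (x : E d) : ℝ :=
  1 / 2 * ‖x - lam • e₂ hd‖ ^ 2
    - lam * Real.log (1 + √(1 - (inner ℝ x (e₁ hd)) ^ 2))
    + lam * √(1 - (inner ℝ x (e₁ hd)) ^ 2)
    + (lam - 1) * Real.log (inner ℝ x (e₁ hd))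

end DouglasRachford

end

open scoped NNReal ENNReal

noncomputable section

namespace DouglasRachford

/-! ### One-variable calculus for Benoist's function -/

/-! For a point x of the slab with image Tx, let τ and s be the values of √(1 - ⟨·, e₁⟩²) at x and
Tx. Benoist's function is half the squared distance to λe₂ plus a function of τ alone, and
`F_sub_F_drPoint` splits F(x) - F(Tx) into `stepDecrease lam s τ` and λ(‖x‖s - ⟨x, e₂⟩). The second
term is nonnegative by Bessel's inequality. The first is positive unless s = τ = λ
(`stepDecrease_pos`), and in that case the second equals F(x) - F(x*). So F strictly decreases off
its minimum level.

The analytic core is `stepDecrease_pos`. The τ-derivative has the sign of q(s) - q(τ), where q =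
`slopeRatio lam` rises and then falls, and the value at τ = s is (λ - s)²/2. This settles s ≥ λ. For
0 < s < λ it reduces τ < s to the endpoints τ = s and τ = 0, the latter handled by polynomial
estimates; τ ≥ s follows from Cauchy-Schwarz.

Sublevel sets of F are compact, so `exists_lipschitz_rate` upgrades strict decrease to a 1-Lipschitz
rate α. Since T maps the half-space into the slab, composing F with T carries this rate to V. A
perturbation costing only a fraction of α leaves a definite decrease, which gives robustness
(`isRobustlyKLStable_of_decrease`). -/

lemma le_of_hasDerivAt_nonneg {f f' : ℝ → ℝ} {a b : ℝ} (hab : a ≤ b)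
    (h : ∀ x ∈ Set.Icc a b, HasDerivAt f (f' x) x) (h0 : ∀ x ∈ Set.Ioo a b, 0 ≤ f' x) :
    f a ≤ f b := by
  refine monotoneOn_of_deriv_nonneg (convex_Icc a b)
    (fun x hx => (h x hx).continuousAt.continuousWithinAt)
    (fun x hx => ?_) (fun x hx => ?_) (Set.left_mem_Icc.2 hab) (Set.right_mem_Icc.2 hab) hab
  · rw [interior_Icc] at hx
    exact (h x (Set.Ioo_subset_Icc_self hx)).differentiableAt.differentiableWithinAt
  · rw [interior_Icc] at hx
    rw [(h x (Set.Ioo_subset_Icc_self hx)).deriv]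
    exact h0 x hx

lemma lt_of_hasDerivAt_pos {f f' : ℝ → ℝ} {a b : ℝ} (hab : a < b)
    (h : ∀ x ∈ Set.Icc a b, HasDerivAt f (f' x) x) (h0 : ∀ x ∈ Set.Ioo a b, 0 < f' x) :
    f a < f b := by
  refine strictMonoOn_of_deriv_pos (convex_Icc a b)
    (fun x hx => (h x hx).continuousAt.continuousWithinAt)
    (fun x hx => ?_) (Set.left_mem_Icc.2 hab.le) (Set.right_mem_Icc.2 hab.le) hab
  rw [interior_Icc] at hx
  rw [(h x (Set.Ioo_subset_Icc_self hx)).deriv]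
  exact h0 x hx

lemma ge_of_hasDerivAt_nonpos {f f' : ℝ → ℝ} {a b : ℝ} (hab : a ≤ b)
    (h : ∀ x ∈ Set.Icc a b, HasDerivAt f (f' x) x) (h0 : ∀ x ∈ Set.Ioo a b, f' x ≤ 0) :
    f b ≤ f a := by
  have := le_of_hasDerivAt_nonneg (f := fun x => -f x) (f' := fun x => -f' x) hab
    (fun x hx => (h x hx).neg) (fun x hx => neg_nonneg.2 (h0 x hx))
  simpa using this

/-- The part of Benoist's function that depends on the first coordinate `t` only,
as a function of `s = √(1 - t²)`. -/
def radialPart (lam s : ℝ) : ℝ :=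
  lam * s - lam * Real.log (1 + s) + (lam - 1) / 2 * Real.log (1 - s ^ 2)

lemma hasDerivAt_radialPart (lam : ℝ) {x : ℝ} (h0 : 0 ≤ x) (h1 : x < 1) :
    HasDerivAt (radialPart lam) (x * (1 - lam * x) / (1 - x ^ 2)) x := by
  have hx : 1 - x ^ 2 ≠ 0 := by nlinarith
  have hx' : 1 + x ≠ 0 := by linarith
  have h := (((hasDerivAt_id x).const_mul lam).sub
    ((((hasDerivAt_id x).const_add 1).log hx').const_mul lam)).add
    (((((hasDerivAt_id x).pow 2).const_sub 1).log hx).const_mul ((lam - 1) / 2))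
  refine h.congr_deriv ?_
  simp only [id, Pi.pow_apply]
  field_simp
  ring

lemma radialPart_zero (lam : ℝ) : radialPart lam 0 = 0 := by simp [radialPart]

/-- `x (λ - x) / √(1 - x²)`. -/
def slopeRatio (lam x : ℝ) : ℝ := x * (lam - x) / √(1 - x ^ 2)

lemma hasDerivAt_sqrt_one_sub_sq {x : ℝ} (h0 : 0 ≤ x) (h1 : x < 1) :
    HasDerivAt (fun x : ℝ => √(1 - x ^ 2)) (-x / √(1 - x ^ 2)) x := by
  have hx : 1 - x ^ 2 ≠ 0 := by nlinarith
  refine ((((hasDerivAt_id x).pow 2).const_sub 1).sqrt hx).congr_deriv ?_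
  have : √(1 - x ^ 2) ≠ 0 := (Real.sqrt_pos.2 (by nlinarith)).ne'
  simp only [id, Pi.pow_apply]
  field_simp
  norm_num

lemma hasDerivAt_slopeRatio (lam : ℝ) {x : ℝ} (h0 : 0 ≤ x) (h1 : x < 1) :
    HasDerivAt (slopeRatio lam) ((lam - 2 * x + x ^ 3) / √(1 - x ^ 2) ^ 3) x := by
  have hr : √(1 - x ^ 2) ≠ 0 := (Real.sqrt_pos.2 (by nlinarith)).ne'
  have hsq : √(1 - x ^ 2) ^ 2 = 1 - x ^ 2 := Real.sq_sqrt (by nlinarith)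
  have h := ((hasDerivAt_id x).mul ((hasDerivAt_id x).const_sub lam)).div
    (hasDerivAt_sqrt_one_sub_sq h0 h1) hr
  refine h.congr_deriv ?_
  simp only [id, Pi.mul_apply]
  field_simp
  rw [hsq]
  ring

/-- The decrease of Benoist's function along a step from a point of height `√(1 - τ²)` to a
point of height `√(1 - s²)`, for points of the half-plane spanned by `e₁` and `e₂`. -/
def stepDecrease (lam s τ : ℝ) : ℝ :=
  (lam ^ 2 - τ ^ 2) / 2 - √(1 - τ ^ 2) * slopeRatio lam s + radialPart lam τ - radialPart lam s

lemma stepDecrease_self (lam : ℝ) {s : ℝ} (h0 : 0 ≤ s) (h1 : s < 1) :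
    stepDecrease lam s s = (lam - s) ^ 2 / 2 := by
  have hr : √(1 - s ^ 2) ≠ 0 := (Real.sqrt_pos.2 (by nlinarith)).ne'
  unfold stepDecrease slopeRatio
  field_simp
  ring

lemma hasDerivAt_stepDecrease (lam s : ℝ) {x : ℝ} (h0 : 0 ≤ x) (h1 : x < 1) :
    HasDerivAt (stepDecrease lam s)
      (x / √(1 - x ^ 2) * (slopeRatio lam s - slopeRatio lam x)) x := by
  have hr : √(1 - x ^ 2) ≠ 0 := (Real.sqrt_pos.2 (by nlinarith)).ne'
  have hsq : √(1 - x ^ 2) ^ 2 = 1 - x ^ 2 := Real.sq_sqrt (by nlinarith)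
  have hx : 1 - x ^ 2 ≠ 0 := by nlinarith
  have h := (((((hasDerivAt_id x).pow 2).const_sub (lam ^ 2)).div_const 2).sub
    ((hasDerivAt_sqrt_one_sub_sq h0 h1).mul_const (slopeRatio lam s))).add
    (hasDerivAt_radialPart lam h0 h1) |>.sub_const (radialPart lam s)
  refine h.congr_deriv ?_
  have : slopeRatio lam x = x * (lam - x) / √(1 - x ^ 2) := rfl
  have h4 : x * (1 - lam * x) / (1 - x ^ 2) = x * (1 - lam * x) / √(1 - x ^ 2) ^ 2 := by rw [hsq]
  rw [this, h4]
  simp only [id]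
  field_simp
  norm_num
  linear_combination (-2 * x) * hsq

/-- The cubic p(x) = λ - 2x + x³ is convex on [0, 1] with p(1) ≤ 0, so it lies below its chord from
x to 1. As p is the numerator of the derivative of `slopeRatio`, it follows that `slopeRatio` can
only switch from increasing to decreasing. -/
lemma cubic_convexity {lam x z : ℝ} (hl : lam ≤ 1) (h0 : 0 ≤ x) (hxz : x ≤ z) (h1 : z ≤ 1) :
    (1 - x) * (lam - 2 * z + z ^ 3) ≤ (1 - z) * (lam - 2 * x + x ^ 3) := by
  have h2 : (1 - z) * (lam - 2 * x + x ^ 3) - (1 - x) * (lam - 2 * z + z ^ 3) =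
      (z - x) * (1 - lam) + (z - x) * (1 - z) * (1 - x) * (x + z + 1) := by ring
  have h3 : 0 ≤ z - x := by linarith
  have h4 : 0 ≤ 1 - z := by linarith
  have h5 : 0 ≤ 1 - x := by linarith
  have h6 : 0 ≤ 1 - lam := by linarith
  have h7 : 0 ≤ x + z + 1 := by linarith
  have : 0 ≤ (z - x) * (1 - lam) + (z - x) * (1 - z) * (1 - x) * (x + z + 1) := by positivity
  linarith

lemma slopeRatio_antitone {lam x y : ℝ} (hl : lam < 1) (h0 : 0 ≤ x) (hxy : x ≤ y) (h1 : y < 1)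
    (hm : lam - 2 * x + x ^ 3 ≤ 0) : slopeRatio lam y ≤ slopeRatio lam x := by
  refine ge_of_hasDerivAt_nonpos hxy
    (fun z hz => hasDerivAt_slopeRatio lam (h0.trans hz.1) (hz.2.trans_lt h1)) fun z hz => ?_
  refine div_nonpos_of_nonpos_of_nonneg ?_ (by positivity)
  have hz1 : z < 1 := hz.2.trans h1
  have hz0 := hz.1
  by_contra! hc
  nlinarith [mul_pos (by linarith : (0 : ℝ) < 1 - x) hc,
    cubic_convexity hl.le h0 hz0.le hz1.le, mul_nonneg (sub_nonneg.2 hz1.le) (neg_nonneg.2 hm)]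

lemma slopeRatio_monotone {lam x y : ℝ} (hl : lam < 1) (h0 : 0 ≤ x) (hxy : x ≤ y) (h1 : y < 1)
    (hm : 0 ≤ lam - 2 * y + y ^ 3) : slopeRatio lam x ≤ slopeRatio lam y := by
  refine le_of_hasDerivAt_nonneg hxy
    (fun z hz => hasDerivAt_slopeRatio lam (h0.trans hz.1) (hz.2.trans_lt h1)) fun z hz => ?_
  refine div_nonneg ?_ (by positivity)
  have hz0 : 0 ≤ z := h0.trans hz.1.le
  by_contra! hc
  nlinarith [mul_neg_of_pos_of_neg (sub_pos.2 h1) hc, cubic_convexity hl.le hz0 hz.2.le h1.le,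
    mul_nonneg (by linarith [hz.2] : (0 : ℝ) ≤ 1 - z) hm]

lemma sqrt_one_sub_sq_pos {x : ℝ} (h0 : 0 ≤ x) (h1 : x < 1) : 0 < √(1 - x ^ 2) :=
  Real.sqrt_pos.2 (by nlinarith)

lemma stepDecrease_mono {lam s a b : ℝ} (h0 : 0 ≤ a) (hab : a ≤ b) (h1 : b < 1)
    (h : ∀ x ∈ Set.Ioo a b, slopeRatio lam x ≤ slopeRatio lam s) :
    stepDecrease lam s a ≤ stepDecrease lam s b :=
  le_of_hasDerivAt_nonneg hab
    (fun _ hz => hasDerivAt_stepDecrease lam s (h0.trans hz.1) (hz.2.trans_lt h1))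
    fun z hz => mul_nonneg (div_nonneg (h0.trans hz.1.le) (Real.sqrt_nonneg _))
      (sub_nonneg.2 (h z hz))

lemma stepDecrease_anti {lam s a b : ℝ} (h0 : 0 ≤ a) (hab : a ≤ b) (h1 : b < 1)
    (h : ∀ x ∈ Set.Ioo a b, slopeRatio lam s ≤ slopeRatio lam x) :
    stepDecrease lam s b ≤ stepDecrease lam s a :=
  ge_of_hasDerivAt_nonpos hab
    (fun _ hz => hasDerivAt_stepDecrease lam s (h0.trans hz.1) (hz.2.trans_lt h1))
    fun z hz => mul_nonpos_of_nonneg_of_nonpos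
      (div_nonneg (h0.trans hz.1.le) (Real.sqrt_nonneg _)) (sub_nonpos.2 (h z hz))

/-! ### Positivity of the decrease, by the relative position of s, τ and λ -/

lemma slopeRatio_self (lam : ℝ) : slopeRatio lam lam = 0 := by simp [slopeRatio]

lemma slopeRatio_pos {lam x : ℝ} (h0 : 0 < x) (h1 : x < 1) (hx : x < lam) :
    0 < slopeRatio lam x :=
  div_pos (mul_pos h0 (sub_pos.2 hx)) (sqrt_one_sub_sq_pos h0.le h1)

lemma slopeRatio_neg {lam x : ℝ} (h0 : 0 < x) (h1 : x < 1) (hx : lam < x) :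
    slopeRatio lam x < 0 :=
  div_neg_of_neg_of_pos (mul_neg_of_pos_of_neg h0 (sub_neg.2 hx)) (sqrt_one_sub_sq_pos h0.le h1)

/-- At `s = λ` the decrease is the excess of Benoist's function over its minimum. -/
lemma stepDecrease_lam_pos {lam τ : ℝ} (hl0 : 0 ≤ lam) (hl1 : lam < 1) (h0 : 0 ≤ τ) (h1 : τ < 1)
    (hne : τ ≠ lam) : 0 < stepDecrease lam lam τ := by
  have hself : stepDecrease lam lam lam = 0 := by simp [stepDecrease_self lam hl0 hl1]
  rcases lt_or_gt_of_ne hne with h | h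
  · have := lt_of_hasDerivAt_pos (f := fun x => -stepDecrease lam lam x) h
      (fun z hz => (hasDerivAt_stepDecrease lam lam (h0.trans hz.1)
        (hz.2.trans_lt hl1)).neg) (fun z hz => by
        have hz0 : 0 < z := h0.trans_lt hz.1
        have hz1 : z < 1 := hz.2.trans hl1
        have := slopeRatio_pos hz0 hz1 hz.2
        have h3 : 0 < z / √(1 - z ^ 2) := div_pos hz0 (sqrt_one_sub_sq_pos hz0.le hz1)
        rw [slopeRatio_self]
        nlinarith)
    linarith
  · have := lt_of_hasDerivAt_pos h
      (fun z hz => hasDerivAt_stepDecrease lam lam (hl0.trans hz.1)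
        (hz.2.trans_lt h1)) (fun z hz => by
        have hz0 : 0 < z := hl0.trans_lt hz.1
        have hz1 : z < 1 := hz.2.trans h1
        have := slopeRatio_neg hz0 hz1 hz.1
        have h3 : 0 < z / √(1 - z ^ 2) := div_pos hz0 (sqrt_one_sub_sq_pos hz0.le hz1)
        rw [slopeRatio_self]
        nlinarith)
    linarith

lemma stepDecrease_lam_nonneg {lam τ : ℝ} (hl0 : 0 ≤ lam) (hl1 : lam < 1) (h0 : 0 ≤ τ)
    (h1 : τ < 1) : 0 ≤ stepDecrease lam lam τ := by
  rcases eq_or_ne τ lam with rfl | h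
  · simp [stepDecrease_self _ hl0 hl1]
  · exact (stepDecrease_lam_pos hl0 hl1 h0 h1 h).le

/-- The minimum over τ is at τ = s: `slopeRatio` is negative at s, decreasing on [λ, 1), and
nonnegative on [0, λ]. -/
lemma stepDecrease_pos_of_lam_lt {lam s τ : ℝ} (hl0 : 0 ≤ lam) (hl1 : lam < 1) (hs : lam < s)
    (hs1 : s < 1) (h0 : 0 ≤ τ) (h1 : τ < 1) : 0 < stepDecrease lam s τ := by
  have hs0 : 0 < s := hl0.trans_lt hs
  have hself : 0 < stepDecrease lam s s := by
    rw [stepDecrease_self lam hs0.le hs1]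
    have : lam - s ≠ 0 := by linarith
    positivity
  have hm : ∀ x, lam ≤ x → x < 1 → lam - 2 * x + x ^ 3 ≤ 0 := fun x hx hx1 => by
    nlinarith [mul_nonneg (mul_nonneg (hl0.trans hx) (sub_nonneg.2 hx1.le))
      (by linarith : 0 ≤ 1 + x)]
  refine hself.trans_le ?_
  rcases le_total τ s with h | h
  · refine stepDecrease_anti h0 h hs1 fun x hx => ?_
    rcases le_total lam x with hx' | hx'
    · exact slopeRatio_antitone hl1 (h0.trans hx.1.le) hx.2.le hs1 (hm x hx' (hx.2.trans hs1))
    · refine (slopeRatio_neg hs0 hs1 hs).le.trans ?_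
      exact div_nonneg (mul_nonneg (h0.trans hx.1.le) (sub_nonneg.2 hx')) (Real.sqrt_nonneg _)
  · exact stepDecrease_mono hs0.le h h1 fun x hx =>
      slopeRatio_antitone hl1 hs0.le hx.1.le (hx.2.trans h1) (hm s hs.le hs1)

/-- `x² (λ - x) / (1 - x²)`. -/
def defect (lam x : ℝ) : ℝ := x ^ 2 * (lam - x) / (1 - x ^ 2)

lemma hasDerivAt_radialPart' (lam : ℝ) {x : ℝ} (h0 : 0 ≤ x) (h1 : x < 1) :
    HasDerivAt (radialPart lam) (x - defect lam x) x := by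
  have hx : 1 - x ^ 2 ≠ 0 := by nlinarith
  refine (hasDerivAt_radialPart lam h0 h1).congr_deriv ?_
  unfold defect
  field_simp
  ring

/-- `x ↦ defect λ x` grows more slowly than the identity. -/
lemma defect_sub_lt {lam s x : ℝ} (hl1 : lam < 1) (hs : 0 < s) (hsx : s < x)
    (h1 : x < 1) : defect lam x - defect lam s < x - s := by
  have hx : 0 < 1 - x ^ 2 := by nlinarith
  have hs' : 0 < 1 - s ^ 2 := by nlinarith
  have e : defect lam x - defect lam s - (x - s) =
      -((x - s) * (1 + s * x - lam * (x + s))) / ((1 - x ^ 2) * (1 - s ^ 2)) := by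
    unfold defect
    field_simp
    ring
  have h2 : 0 < 1 + s * x - lam * (x + s) := by
    nlinarith [mul_pos (sub_pos.2 hl1) (by linarith : 0 < x + s),
      mul_pos (sub_pos.2 h1) (sub_pos.2 (hsx.trans h1))]
  have h3 : -((x - s) * (1 + s * x - lam * (x + s))) / ((1 - x ^ 2) * (1 - s ^ 2)) < 0 :=
    div_neg_of_neg_of_pos (neg_neg_of_pos (mul_pos (sub_pos.2 hsx) h2)) (mul_pos hx hs')
  linarith

/-- Cauchy-Schwarz, √(1 - τ²)√(1 - s²) ≤ 1 - sτ with equality at τ = s, replaces the root by an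
affine function of τ. The lower bound ψ so obtained has derivative `defect lam s - defect lam τ`,
which exceeds -(τ - s) for τ > s. Hence up to λ it loses less than (τ - s)²/2 of its initial (λ -
s)²/2, and beyond λ it does not decrease. -/
lemma stepDecrease_pos_of_le {lam s τ : ℝ} (hl1 : lam < 1) (hs0 : 0 < s) (hs : s < lam)
    (hsτ : s ≤ τ) (h1 : τ < 1) : 0 < stepDecrease lam s τ := by
  have hs1 : s < 1 := hs.trans hl1
  have hs2 : 0 < 1 - s ^ 2 := by nlinarith
  have hr := sqrt_one_sub_sq_pos hs0.le hs1
  have hrsq : √(1 - s ^ 2) ^ 2 = 1 - s ^ 2 := Real.sq_sqrt hs2.le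
  set ψ : ℝ → ℝ := fun x => (lam ^ 2 - x ^ 2) / 2 - s * (lam - s) / (1 - s ^ 2) * (1 - s * x) +
    radialPart lam x - radialPart lam s with hψ
  have hd : ∀ x, 0 ≤ x → x < 1 → HasDerivAt ψ (defect lam s - defect lam x) x := fun x h0 h1 => by
    have h := (((((hasDerivAt_id x).pow 2).const_sub (lam ^ 2)).div_const 2).sub
      ((((hasDerivAt_id x).const_mul s).const_sub 1).const_mul
        (s * (lam - s) / (1 - s ^ 2)))).add
      (hasDerivAt_radialPart' lam h0 h1) |>.sub_const (radialPart lam s)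
    refine h.congr_deriv ?_
    simp only [id, defect]
    field_simp
    ring
  have hψs : ψ s = (lam - s) ^ 2 / 2 := by
    simp only [hψ]
    field_simp
    ring
  have hle : ψ τ ≤ stepDecrease lam s τ := by
    have hτ : 0 ≤ 1 - τ ^ 2 := by nlinarith
    have hc : √(1 - τ ^ 2) * √(1 - s ^ 2) ≤ 1 - s * τ := by
      rw [← Real.sqrt_mul hτ]
      refine Real.sqrt_le_iff.2 ⟨by nlinarith, by nlinarith [sq_nonneg (s - τ)]⟩
    have : √(1 - τ ^ 2) * slopeRatio lam s =
        s * (lam - s) / (1 - s ^ 2) * (√(1 - τ ^ 2) * √(1 - s ^ 2)) := by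
      have h3 : s * (lam - s) / (1 - s ^ 2) = s * (lam - s) / √(1 - s ^ 2) ^ 2 := by rw [hrsq]
      rw [h3]
      unfold slopeRatio
      field_simp
    have h2 : 0 ≤ s * (lam - s) / (1 - s ^ 2) :=
      div_nonneg (mul_nonneg hs0.le (sub_nonneg.2 hs.le)) hs2.le
    simp only [hψ, stepDecrease, this]
    nlinarith [mul_le_mul_of_nonneg_left hc h2]
  refine lt_of_lt_of_le ?_ hle
  have key : ∀ y, s < y → y ≤ lam → 0 < ψ y := fun y hy hyl => by
    have := lt_of_hasDerivAt_pos (f := fun x => ψ x + (x - s) ^ 2 / 2) hy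
      (fun z hz => (hd z (hs0.le.trans hz.1) (hz.2.trans_lt (hyl.trans_lt hl1))).add
        ((((hasDerivAt_id z).sub_const s).pow 2).div_const 2)) (fun z hz => by
        have := defect_sub_lt hl1 hs0 hz.1 (hz.2.trans (hyl.trans_lt hl1))
        simp only [id]
        norm_num
        linarith)
    simp only [hψs] at this
    nlinarith
  rcases hsτ.eq_or_lt with rfl | hsτ
  · rw [hψs]
    have : lam - s ≠ 0 := by linarith
    positivity
  rcases le_total τ lam with h | h
  · exact key τ hsτ h
  · refine (key lam hs le_rfl).trans_le (le_of_hasDerivAt_nonneg h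
      (fun z hz => hd z ((hs0.trans hs).le.trans hz.1) (hz.2.trans_lt h1)) fun z hz => ?_)
    have hz0 : 0 < 1 - z ^ 2 := by nlinarith [hz.1, hz.2]
    have e1 : 0 ≤ defect lam s :=
      div_nonneg (mul_nonneg (sq_nonneg _) (sub_nonneg.2 hs.le)) hs2.le
    have e2 : defect lam z ≤ 0 :=
      div_nonpos_of_nonpos_of_nonneg
        (mul_nonpos_of_nonneg_of_nonpos (sq_nonneg _) (sub_nonpos.2 hz.1.le)) hz0.le
    linarith

/-! ### Polynomial estimates for the endpoint τ = 0 -/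

/-- Integrates x²/(1 - x²) ≥ x² + x⁴ + x⁶, multiplied by λ - x ≥ 0, in the derivative x - `defect
lam x`. -/
lemma radialPart_le {lam s : ℝ} (h0 : 0 ≤ s) (hs : s ≤ lam) (h1 : s < 1) :
    radialPart lam s ≤ s ^ 2 / 2 - (lam * (s ^ 3 / 3 + s ^ 5 / 5 + s ^ 7 / 7) -
      (s ^ 4 / 4 + s ^ 6 / 6 + s ^ 8 / 8)) := by
  have hd : ∀ x, 0 ≤ x → x < 1 → HasDerivAt (fun x => x ^ 2 / 2 -
      (lam * (x ^ 3 / 3 + x ^ 5 / 5 + x ^ 7 / 7) - (x ^ 4 / 4 + x ^ 6 / 6 + x ^ 8 / 8)) -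
      radialPart lam x)
      (x - (lam * (x ^ 2 + x ^ 4 + x ^ 6) - (x ^ 3 + x ^ 5 + x ^ 7)) -
        (x - defect lam x)) x := fun x hx0 hx1 => by
    have h := ((((hasDerivAt_pow 2 x).div_const 2).sub
      (((((hasDerivAt_pow 3 x).div_const 3).add ((hasDerivAt_pow 5 x).div_const 5)).add
        ((hasDerivAt_pow 7 x).div_const 7)).const_mul lam |>.sub
      ((((hasDerivAt_pow 4 x).div_const 4).add ((hasDerivAt_pow 6 x).div_const 6)).add
        ((hasDerivAt_pow 8 x).div_const 8)))).sub (hasDerivAt_radialPart' lam hx0 hx1))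
    refine h.congr_deriv ?_
    norm_num
  have := le_of_hasDerivAt_nonneg h0 (fun x hx => hd x hx.1 (hx.2.trans_lt h1)) fun x hx => by
    have hx0 := hx.1
    have hx1 := hx.2
    have hx2 : 0 < 1 - x ^ 2 := by nlinarith
    have e : x - (lam * (x ^ 2 + x ^ 4 + x ^ 6) - (x ^ 3 + x ^ 5 + x ^ 7)) - (x - defect lam x) =
        x ^ 8 * (lam - x) / (1 - x ^ 2) := by
      unfold defect
      field_simp
      ring
    rw [e]
    exact div_nonneg (mul_nonneg (by positivity) (by linarith)) hx2.le
  simp only [radialPart_zero] at this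
  norm_num at this
  linarith

/-- Squared form of an upper bound for 1/√(1 - s²). Multiplied by s, the terms s²/3, s⁴/5, s⁶/7
cancel those of `radialPart_le`; the coefficients 2/5 and 2/25 are small enough for the later
completion of the square. -/
lemma polynomial_bound {s : ℝ} (h0 : 0 < s) (h1 : s ≤ 4 / 5) :
    1 ≤ (1 + (2 / 5 * s + s ^ 2 / 3 + 2 / 25 * s ^ 3 + s ^ 4 / 5 + s ^ 6 / 7)) ^ 2 *
      (1 - s ^ 2) := by
  have h : ∀ n : ℕ, s ^ n ≤ (4 / 5) ^ n := fun n => pow_le_pow_left₀ h0.le h1 n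
  have e : (1 + (2 / 5 * s + s ^ 2 / 3 + 2 / 25 * s ^ 3 + s ^ 4 / 5 + s ^ 6 / 7)) ^ 2 *
      (1 - s ^ 2) - 1 = s * (4 / 5 - 13 / 75 * s - 28 / 75 * s ^ 2 - 283 / 1125 * s ^ 3
        - 16 / 75 * s ^ 4 - 5893 / 39375 * s ^ 5 - 176 / 2625 * s ^ 6 - 3809 / 13125 * s ^ 7
        - 108 / 875 * s ^ 8 - 41 / 525 * s ^ 9 - 4 / 175 * s ^ 10 - 9 / 245 * s ^ 11
        - 1 / 49 * s ^ 13) := by ring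
  -- All coefficients after the constant are negative, so each power may be replaced by its value at
  -- 4/5.
  have h2 : 0 ≤ 4 / 5 - 13 / 75 * s - 28 / 75 * s ^ 2 - 283 / 1125 * s ^ 3
        - 16 / 75 * s ^ 4 - 5893 / 39375 * s ^ 5 - 176 / 2625 * s ^ 6 - 3809 / 13125 * s ^ 7
        - 108 / 875 * s ^ 8 - 41 / 525 * s ^ 9 - 4 / 175 * s ^ 10 - 9 / 245 * s ^ 11
        - 1 / 49 * s ^ 13 := by
    have a2 := h 2; have a3 := h 3; have a4 := h 4; have a5 := h 5; have a6 := h 6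
    have a7 := h 7; have a8 := h 8; have a9 := h 9; have a10 := h 10; have a11 := h 11
    have a13 := h 13
    norm_num at a2 a3 a4 a5 a6 a7 a8 a9 a10 a11 a13
    linarith
  nlinarith [mul_nonneg h0.le h2]

/-- Serves the endpoint λ = 1, with √((1 - s)/(1 + s)) replaced by its AM-GM bound of weight 13/50;
on [4/5, 1) that root ranges over (0, 1/3]. -/
lemma polynomial_bound' {s : ℝ} (h0 : 4 / 5 ≤ s) (h1 : s < 1) :
    s * (((1 - s) / (1 + s) / (13 / 50) + 13 / 50) / 2) <
      (1 - s) ^ 2 / 2 + s * (1 - s) + (1 - s) * (s ^ 3 / 3 + s ^ 5 / 5 + s ^ 7 / 7) +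
      (s ^ 4 / 12 + s ^ 6 / 30 + s ^ 8 / 56) := by
  have hs : 0 < 1 + s := by linarith
  have e : s * (((1 - s) / (1 + s) / (13 / 50) + 13 / 50) / 2) =
      s * ((1 - s) / (13 / 50) + 13 / 50 * (1 + s)) / 2 / (1 + s) := by
    field_simp
  rw [e, div_lt_iff₀ hs]
  -- Around 4/5 the powers of y from the cube on are bounded by multiples of y, and y² only by its
  -- sign, which leaves a linear problem.
  obtain ⟨y, rfl⟩ : ∃ y, s = 4 / 5 + y := ⟨s - 4 / 5, by ring⟩
  have hy0 : 0 ≤ y := by linarith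
  have hy1 : y ≤ 1 / 5 := by linarith
  have hp : ∀ n : ℕ, y ^ (n + 1) ≤ y * (1 / 5) ^ n := fun n => by
    rw [pow_succ']
    exact mul_le_mul_of_nonneg_left (pow_le_pow_left₀ hy0 hy1 n) hy0
  have a3 := hp 2; have a4 := hp 3; have a5 := hp 4; have a6 := hp 5; have a7 := hp 6
  have a8 := hp 7; have a9 := hp 8
  norm_num at a3 a4 a5 a6 a7 a8 a9
  have a2 : 0 ≤ y ^ 2 := sq_nonneg y
  ring_nf
  linarith

/-- The decrease of Benoist's function is positive at height `1`. -/
lemma stepDecrease_zero_pos {lam s : ℝ} (hl1 : lam < 1) (h0 : 0 < s) (hs : s < lam) :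
    0 < stepDecrease lam s 0 := by
  have h1 : s < 1 := hs.trans hl1
  have hG := radialPart_le h0.le hs.le h1
  have hr := sqrt_one_sub_sq_pos h0.le h1
  have hrsq : √(1 - s ^ 2) ^ 2 = 1 - s ^ 2 := Real.sq_sqrt (by nlinarith)
  have hq : slopeRatio lam s = s * (lam - s) * (√(1 - s ^ 2))⁻¹ := by
    rw [slopeRatio, div_eq_mul_inv]
  obtain ⟨u, rfl⟩ : ∃ u, lam = s + u := ⟨lam - s, by ring⟩
  have hu : 0 < u := by linarith
  have hu1 : u < 1 - s := by linarith
  set ρ := (√(1 - s ^ 2))⁻¹ with hρ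
  have hρ0 : 0 < ρ := inv_pos.2 hr
  have hρsq : ρ ^ 2 * (1 - s ^ 2) = 1 := by
    rw [← hrsq, hρ]
    field_simp
  have e : stepDecrease (s + u) s 0 = (s + u) ^ 2 / 2 - s * u * ρ - radialPart (s + u) s := by
    simp [stepDecrease, hq, radialPart_zero]
  rw [e]
  -- With λ = s + u the truncated bound is quadratic in u; 1/12, 1/30, 1/56 are 1/3 - 1/4, 1/5 -
  -- 1/6, 1/7 - 1/8.
  have main : 0 < u ^ 2 / 2 + s * u - s * u * ρ + u * (s ^ 3 / 3 + s ^ 5 / 5 + s ^ 7 / 7) +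
      (s ^ 4 / 12 + s ^ 6 / 30 + s ^ 8 / 56) := by
    rcases le_total s (4 / 5) with h | h
    · have hW := polynomial_bound h0 h
      have hρW : ρ ≤ 1 + (2 / 5 * s + s ^ 2 / 3 + 2 / 25 * s ^ 3 + s ^ 4 / 5 + s ^ 6 / 7) := by
        refine le_of_sq_le_sq ?_ (by positivity)
        have : 0 < 1 - s ^ 2 := by nlinarith
        refine le_of_mul_le_mul_right ?_ this
        rw [hρsq]
        exact hW
      have h3 := mul_le_mul_of_nonneg_left hρW (mul_pos h0 hu).le
      have h4 : 0 < s ^ 4 := by positivity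
      have h6 : 0 < s ^ 6 := by positivity
      have h8 : 0 < s ^ 8 := by positivity
      -- Half the square has constant part 2s⁴/25 + 4s⁶/125 + 2s⁸/625, below s⁴/12 + s⁶/30 + s⁸/56.
      nlinarith [sq_nonneg (u - s ^ 2 * (2 / 5 + 2 / 25 * s ^ 2))]
    · have hE := polynomial_bound' h h1
      have hs1 : 0 < 1 - s := by linarith
      have hρZ : ρ * (1 - s) ≤ ((1 - s) / (1 + s) / (13 / 50) + 13 / 50) / 2 := by
        have : (1 - s) / (1 + s) = (ρ * (1 - s)) ^ 2 := by
          have : 0 < 1 + s := by linarith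
          rw [div_eq_iff this.ne']
          linear_combination -(1 - s) * hρsq
        rw [this]
        nlinarith [sq_nonneg (ρ * (1 - s) - 13 / 50)]
      have hA0 : 0 < (s ^ 4 / 12 + s ^ 6 / 30 + s ^ 8 / 56) - (1 - s) ^ 2 / 2 := by
        have h4 : (4 / 5 : ℝ) ^ 4 ≤ s ^ 4 := pow_le_pow_left₀ (by norm_num) h 4
        have h6 : 0 < s ^ 6 := by positivity
        have h8 : 0 < s ^ 8 := by positivity
        norm_num at h4
        nlinarith
      have hA1 : 0 < (1 - s) ^ 2 / 2 + s * (1 - s) - s * (ρ * (1 - s)) +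
          (1 - s) * (s ^ 3 / 3 + s ^ 5 / 5 + s ^ 7 / 7) +
          (s ^ 4 / 12 + s ^ 6 / 30 + s ^ 8 / 56) := by
        have := mul_le_mul_of_nonneg_left hρZ h0.le
        linarith
      -- Replacing u²/2 by its tangent at u = 1 - s bounds the quadratic below by an affine function
      -- of u, positive at u = 0 by `hA0` and at u = 1 - s by `hA1`.
      have h5 : 0 < (1 - s) * (u ^ 2 / 2 + s * u - s * u * ρ +
          u * (s ^ 3 / 3 + s ^ 5 / 5 + s ^ 7 / 7) + (s ^ 4 / 12 + s ^ 6 / 30 + s ^ 8 / 56)) := by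
        have h6 := mul_pos (sub_pos.2 hu1) hA0
        have h7 := mul_pos hu hA1
        have h8 := mul_nonneg hs1.le (sq_nonneg (u - (1 - s)))
        linarith
      exact pos_of_mul_pos_right h5 hs1.le
  nlinarith

/-- By unimodality of `slopeRatio`, the decrease as a function of τ on [0, s] rises and then
possibly falls, so it is bounded below by its value at 0 or at s. -/
lemma stepDecrease_pos_of_lt {lam s τ : ℝ} (hl1 : lam < 1) (h0 : 0 ≤ τ) (hτ : τ < s)
    (hs : s < lam) : 0 < stepDecrease lam s τ := by
  have hs0 : 0 < s := h0.trans_lt hτ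
  have hs1 : s < 1 := hs.trans hl1
  have hself : 0 < stepDecrease lam s s := by
    rw [stepDecrease_self lam hs0.le hs1]
    have : lam - s ≠ 0 := by linarith
    positivity
  have hsmall : τ < 1 := hτ.trans hs1
  by_cases hm : 0 ≤ lam - 2 * τ + τ ^ 3
  · rcases le_total (slopeRatio lam τ) (slopeRatio lam s) with h | h
    · refine (stepDecrease_zero_pos hl1 hs0 hs).trans_le
        (stepDecrease_mono le_rfl h0 hsmall fun x hx => ?_)
      exact (slopeRatio_monotone hl1 hx.1.le hx.2.le hsmall hm).trans h
    · refine hself.trans_le (stepDecrease_anti h0 hτ.le hs1 fun x hx => ?_)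
      have hx0 : 0 ≤ x := h0.trans hx.1.le
      rcases le_total (lam - 2 * x + x ^ 3) 0 with h' | h'
      · exact slopeRatio_antitone hl1 hx0 hx.2.le hs1 h'
      · exact h.trans (slopeRatio_monotone hl1 h0 hx.1.le (hx.2.trans hs1) h')
  · push Not at hm
    refine hself.trans_le (stepDecrease_anti h0 hτ.le hs1 fun x hx => ?_)
    refine slopeRatio_antitone hl1 (h0.trans hx.1.le) hx.2.le hs1 ?_
    by_contra! hc
    nlinarith [cubic_convexity hl1.le h0 hx.1.le (hx.2.trans hs1).le,
      mul_pos (sub_pos.2 hsmall) hc, mul_neg_of_pos_of_neg (sub_pos.2 (hx.2.trans hs1)) hm]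

theorem stepDecrease_pos {lam s τ : ℝ} (hl0 : 0 ≤ lam) (hl1 : lam < 1) (hs0 : 0 ≤ s)
    (hs1 : s < 1) (h0 : 0 ≤ τ) (h1 : τ < 1) (hne : ¬(s = lam ∧ τ = lam)) :
    0 < stepDecrease lam s τ := by
  rcases lt_trichotomy s lam with h | rfl | h
  · rcases hs0.eq_or_lt with rfl | hs
    · have e : stepDecrease lam 0 τ = stepDecrease lam lam τ + radialPart lam lam := by
        -- The `slopeRatio` term vanishes both at s = 0 and at s = λ, so only the `radialPart` terms
        -- differ.
        simp only [stepDecrease, slopeRatio, radialPart_zero]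
        ring
      have h2 := lt_of_hasDerivAt_pos h
        (fun z hz => hasDerivAt_radialPart lam hz.1 (hz.2.trans_lt hl1)) fun z hz => by
          have hz0 := hz.1
          have hz1 := hz.2
          exact div_pos (mul_pos hz0 (by nlinarith)) (by nlinarith)
      rw [radialPart_zero] at h2
      rw [e]
      exact add_pos_of_nonneg_of_pos (stepDecrease_lam_nonneg hl0 hl1 h0 h1) h2
    · rcases le_or_gt s τ with h' | h'
      · exact stepDecrease_pos_of_le hl1 hs h h' h1
      · exact stepDecrease_pos_of_lt hl1 h0 h' h
  · exact stepDecrease_lam_pos hl0 hl1 h0 h1 fun h => hne ⟨rfl, h⟩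
  · exact stepDecrease_pos_of_lam_lt hl0 hl1 h hs1 h0 h1

/-! ### The Douglas-Rachford operator of the sphere and the line -/

section Operator

variable {d : ℕ}

lemma norm_e₁ (hd : 2 ≤ d) : ‖e₁ hd‖ = 1 := by simp [e₁]

lemma norm_e₂ (hd : 2 ≤ d) : ‖e₂ hd‖ = 1 := by simp [e₂]

lemma inner_e₁_e₁ (hd : 2 ≤ d) : inner ℝ (e₁ hd) (e₁ hd) = 1 := by
  rw [real_inner_self_eq_norm_sq, norm_e₁, one_pow]

lemma inner_e₂_e₂ (hd : 2 ≤ d) : inner ℝ (e₂ hd) (e₂ hd) = 1 := by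
  rw [real_inner_self_eq_norm_sq, norm_e₂, one_pow]

lemma inner_e₂_e₁ (hd : 2 ≤ d) : inner ℝ (e₂ hd) (e₁ hd) = 0 := by
  simp [e₁, e₂, EuclideanSpace.inner_single_left]

lemma inner_e₁_e₂ (hd : 2 ≤ d) : inner ℝ (e₁ hd) (e₂ hd) = 0 := by
  simp [e₁, e₂, EuclideanSpace.inner_single_left]

/-- A point whose distance to `x` is minimal with quadratic growth is the unique projection. -/
lemma proj_eq_singleton {A : Set (E d)} {x p : E d} {c : ℝ} (hp : p ∈ A) (hc : 0 < c)
    (h : ∀ z ∈ A, ‖x - z‖ ^ 2 = ‖x - p‖ ^ 2 + c * ‖z - p‖ ^ 2) : proj A x = {p} := by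
  have hle : ∀ z ∈ A, ‖x - p‖ ≤ ‖x - z‖ := fun z hz => by
    refine le_of_sq_le_sq ?_ (norm_nonneg _)
    rw [h z hz]
    have : 0 ≤ c * ‖z - p‖ ^ 2 := by positivity
    linarith
  have hinf : ⨅ z : A, ‖x - (z : E d)‖ = ‖x - p‖ := by
    have : Nonempty A := ⟨⟨p, hp⟩⟩
    refine le_antisymm (ciInf_le ⟨0, ?_⟩ (⟨p, hp⟩ : A)) (le_ciInf fun z => hle z z.2)
    rintro _ ⟨z, rfl⟩
    exact norm_nonneg _
  ext z
  simp only [proj, Set.mem_ofPred_eq, Set.mem_singleton_iff, hinf]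
  refine ⟨fun ⟨hz, hz'⟩ => ?_, fun hz => by subst hz; exact ⟨hp, rfl⟩⟩
  have h1 := h z hz
  rw [hz'] at h1
  have h2 : c * ‖z - p‖ ^ 2 = 0 := by linarith
  have h3 : ‖z - p‖ = 0 := by
    rcases mul_eq_zero.1 h2 with h | h
    · exact absurd h hc.ne'
    · exact pow_eq_zero_iff (two_ne_zero) |>.1 h
  exact sub_eq_zero.1 (norm_eq_zero.1 h3)

lemma proj_sphere {x : E d} (hx : x ≠ 0) : proj (sphere d) x = {‖x‖⁻¹ • x} := by
  have hx' : ‖x‖ ≠ 0 := norm_ne_zero_iff.2 hx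
  -- For unit z and p = x/‖x‖, ‖x - z‖² = (‖x‖ - 1)² + ‖x‖‖z - p‖².
  refine proj_eq_singleton (c := ‖x‖) ?_ (norm_pos_iff.2 hx) fun z hz => ?_
  · simp [sphere, norm_smul, hx']
  · have hz' : ‖z‖ = 1 := hz
    simp only [@norm_sub_sq_real, inner_smul_right, norm_smul, norm_inv, norm_norm, hz',
      real_inner_self_eq_norm_sq, real_inner_comm x z]
    field_simp
    ring

lemma proj_line (hd : 2 ≤ d) (lam : ℝ) (y : E d) :
    proj (line hd lam) y = {inner ℝ y (e₁ hd) • e₁ hd + lam • e₂ hd} := by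
  refine proj_eq_singleton (c := 1) ⟨_, rfl⟩ one_pos ?_
  rintro _ ⟨t, rfl⟩
  simp only [← real_inner_self_eq_norm_sq, inner_sub_left, inner_sub_right, inner_add_left,
    inner_add_right, real_inner_smul_left, inner_smul_right, inner_e₁_e₁, inner_e₂_e₂,
    inner_e₁_e₂, inner_e₂_e₁, real_inner_comm y]
  ring

/-- The single-valued Douglas-Rachford operator of the sphere and the line. -/
def drPoint (hd : 2 ≤ d) (lam : ℝ) (x : E d) : E d :=
  x - ‖x‖⁻¹ • x + (2 * inner ℝ x (e₁ hd) / ‖x‖ - inner ℝ x (e₁ hd)) • e₁ hd + lam • e₂ hd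

lemma drOperator_eq (hd : 2 ≤ d) (lam : ℝ) {x : E d} (hx : x ≠ 0) :
    drOperator (sphere d) (line hd lam) x = {drPoint hd lam x} := by
  ext w
  simp only [drOperator, refl, proj_sphere hx, proj_line, Set.mem_singleton_iff, exists_eq_left,
    Set.mem_ofPred_eq]
  have : (2⁻¹ : ℝ) • (x + ((2 : ℝ) • (inner ℝ ((2 : ℝ) • ‖x‖⁻¹ • x - x) (e₁ hd) • e₁ hd +
      lam • e₂ hd) - ((2 : ℝ) • ‖x‖⁻¹ • x - x))) = drPoint hd lam x := by
    simp only [drPoint, inner_sub_left, real_inner_smul_left]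
    module
  rw [this]

lemma ne_zero_of_mem_halfSpace {hd : 2 ≤ d} {x : E d} (hx : x ∈ halfSpace hd) : x ≠ 0 := by
  rintro rfl
  simp [halfSpace] at hx

lemma inner_drPoint (hd : 2 ≤ d) (lam : ℝ) {x : E d} :
    inner ℝ (drPoint hd lam x) (e₁ hd) = inner ℝ x (e₁ hd) / ‖x‖ := by
  simp only [drPoint, inner_sub_left, inner_add_left, real_inner_smul_left, inner_e₁_e₁,
    inner_e₂_e₁]
  ring

lemma drPoint_mem_slab (hd : 2 ≤ d) (lam : ℝ) {x : E d} (hx : x ∈ halfSpace hd) :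
    drPoint hd lam x ∈ slab hd := by
  have h0 := norm_pos_iff.2 (ne_zero_of_mem_halfSpace hx)
  have h1 := real_inner_le_norm x (e₁ hd)
  rw [norm_e₁, mul_one] at h1
  simp only [slab, Set.mem_ofPred_eq, inner_drPoint]
  exact ⟨div_pos hx h0, (div_le_one h0).2 h1⟩

lemma slab_subset_halfSpace (hd : 2 ≤ d) : slab hd ⊆ halfSpace hd := fun _ hx => hx.1

lemma norm_drPoint_sub_sq (hd : 2 ≤ d) (lam : ℝ) {x : E d} (hx : x ≠ 0) :
    ‖drPoint hd lam x - lam • e₂ hd‖ ^ 2 =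
      (‖x‖ - 1) ^ 2 + (2 / ‖x‖ - 1) * inner ℝ x (e₁ hd) ^ 2 := by
  have hx' : ‖x‖ ≠ 0 := norm_ne_zero_iff.2 hx
  have e : drPoint hd lam x - lam • e₂ hd =
    (1 - ‖x‖⁻¹) • x + ((2 / ‖x‖ - 1) * inner ℝ x (e₁ hd)) • e₁ hd := by
    rw [drPoint]
    module
  rw [e, ← real_inner_self_eq_norm_sq]
  simp only [inner_add_left, inner_add_right, real_inner_smul_left, inner_smul_right,
    norm_e₁, real_inner_self_eq_norm_sq, real_inner_comm x]
  field_simp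
  ring

lemma continuousOn_drPoint (hd : 2 ≤ d) (lam : ℝ) :
    ContinuousOn (drPoint hd lam) (halfSpace hd) := by
  have h : ∀ x ∈ halfSpace hd, ‖x‖ ≠ 0 := fun x hx =>
    norm_ne_zero_iff.2 (ne_zero_of_mem_halfSpace hx)
  unfold drPoint
  fun_prop (disch := exact h)

lemma isOpen_halfSpace (hd : 2 ≤ d) : IsOpen (halfSpace hd) :=
  isOpen_lt continuous_const (by fun_prop)

/-! ### Benoist's function -/

/-- The radius of the horizontal circle of the sphere at height `⟨x, e₁⟩`. -/
def circleRadius (hd : 2 ≤ d) (x : E d) : ℝ := √(1 - (inner ℝ x (e₁ hd)) ^ 2)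

lemma circleRadius_nonneg (hd : 2 ≤ d) (x : E d) : 0 ≤ circleRadius hd x := Real.sqrt_nonneg _

lemma circleRadius_sq {hd : 2 ≤ d} {x : E d} (hx : x ∈ slab hd) :
    circleRadius hd x ^ 2 = 1 - inner ℝ x (e₁ hd) ^ 2 :=
  Real.sq_sqrt (by nlinarith [hx.1, hx.2])

lemma sqrt_one_sub_circleRadius_sq {hd : 2 ≤ d} {x : E d} (hx : x ∈ slab hd) :
    √(1 - circleRadius hd x ^ 2) = inner ℝ x (e₁ hd) := by
  rw [circleRadius_sq hx, sub_sub_cancel, Real.sqrt_sq hx.1.le]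

lemma circleRadius_lt_one {hd : 2 ≤ d} {x : E d} (hx : x ∈ slab hd) : circleRadius hd x < 1 := by
  have h1 := circleRadius_sq hx
  have h2 := hx.1
  nlinarith [circleRadius_nonneg hd x]

lemma F_eq {hd : 2 ≤ d} (lam : ℝ) {x : E d} (hx : x ∈ slab hd) :
    F hd lam x = ‖x - lam • e₂ hd‖ ^ 2 / 2 + radialPart lam (circleRadius hd x) := by
  have h1 : 1 - circleRadius hd x ^ 2 = inner ℝ x (e₁ hd) ^ 2 := by
    rw [circleRadius_sq hx]
    ring
  rw [radialPart, h1, Real.log_pow, F, circleRadius]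
  push_cast
  ring

lemma xStar_mem_slab (hd : 2 ≤ d) {lam : ℝ} (hl0 : 0 ≤ lam) (hl1 : lam < 1) :
    xStar hd lam ∈ slab hd := by
  simp only [slab, Set.mem_ofPred_eq, xStar, inner_add_left, real_inner_smul_left, inner_e₁_e₁,
    inner_e₂_e₁]
  have : √(1 - lam ^ 2) ≤ 1 := Real.sqrt_le_one.2 (by nlinarith)
  have := sqrt_one_sub_sq_pos hl0 hl1
  constructor <;> linarith

lemma F_xStar (hd : 2 ≤ d) {lam : ℝ} (hl0 : 0 ≤ lam) (hl1 : lam < 1) :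
    F hd lam (xStar hd lam) = (1 - lam ^ 2) / 2 + radialPart lam lam := by
  have hi : inner ℝ (xStar hd lam) (e₁ hd) = √(1 - lam ^ 2) := by
    simp [xStar, inner_add_left, real_inner_smul_left, norm_e₁, inner_e₂_e₁]
  have hsq : √(1 - lam ^ 2) ^ 2 = 1 - lam ^ 2 := Real.sq_sqrt (by nlinarith)
  rw [F_eq lam (xStar_mem_slab hd hl0 hl1), circleRadius, hi, hsq, sub_sub_cancel,
    Real.sqrt_sq hl0]
  simp [xStar, norm_smul, norm_e₁, hsq]

lemma sq_inner_add_sq_inner_le (hd : 2 ≤ d) (x : E d) :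
    inner ℝ x (e₁ hd) ^ 2 + inner ℝ x (e₂ hd) ^ 2 ≤ ‖x‖ ^ 2 := by
  have : 0 ≤ ‖x - inner ℝ x (e₁ hd) • e₁ hd - inner ℝ x (e₂ hd) • e₂ hd‖ ^ 2 := by positivity
  simp only [← real_inner_self_eq_norm_sq, inner_sub_left, inner_sub_right,
    real_inner_smul_left, inner_smul_right, inner_e₁_e₁, inner_e₂_e₂,
    inner_e₁_e₂, inner_e₂_e₁, real_inner_comm x] at this
  rw [← real_inner_self_eq_norm_sq]
  nlinarith

lemma sq_inner_le_norm_sub_sq (hd : 2 ≤ d) (lam : ℝ) (x : E d) :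
    inner ℝ x (e₁ hd) ^ 2 ≤ ‖x - lam • e₂ hd‖ ^ 2 := by
  have h := sq_inner_add_sq_inner_le hd (x - lam • e₂ hd)
  have e : inner ℝ (x - lam • e₂ hd) (e₁ hd) = inner ℝ x (e₁ hd) := by
    simp [inner_sub_left, real_inner_smul_left, inner_e₂_e₁]
  rw [e] at h
  nlinarith [sq_nonneg (inner ℝ (x - lam • e₂ hd) (e₂ hd))]

/-- Bounding ‖x - λe₂‖² below by ⟨x, e₁⟩² = 1 - τ² leaves exactly `stepDecrease lam lam τ` as the
excess. -/
lemma F_xStar_le {hd : 2 ≤ d} {lam : ℝ} (hl0 : 0 ≤ lam) (hl1 : lam < 1) {x : E d}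
    (hx : x ∈ slab hd) : F hd lam (xStar hd lam) ≤ F hd lam x := by
  have h := stepDecrease_lam_nonneg hl0 hl1 (circleRadius_nonneg hd x) (circleRadius_lt_one hx)
  have h2 := sq_inner_le_norm_sub_sq hd lam x
  rw [F_xStar hd hl0 hl1, F_eq lam hx]
  simp only [stepDecrease, slopeRatio_self] at h
  linarith [circleRadius_sq hx]

/-- The first coordinate of Tx is ⟨x, e₁⟩/‖x‖, so ‖x‖ = √(1 - τ²)/√(1 - s²). Thus s, τ and ⟨x, e₂⟩
determine the difference. -/
lemma F_sub_F_drPoint {hd : 2 ≤ d} (lam : ℝ) {x : E d} (hx : x ∈ slab hd) :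
    F hd lam x - F hd lam (drPoint hd lam x) =
      stepDecrease lam (circleRadius hd (drPoint hd lam x)) (circleRadius hd x) +
        lam * (‖x‖ * circleRadius hd (drPoint hd lam x) - inner ℝ x (e₂ hd)) := by
  have hx0 := ne_zero_of_mem_halfSpace (slab_subset_halfSpace hd hx)
  have hρ : 0 < ‖x‖ := norm_pos_iff.2 hx0
  have hT := drPoint_mem_slab hd lam (slab_subset_halfSpace hd hx)
  rw [F_eq lam hx, F_eq lam hT, norm_drPoint_sub_sq hd lam hx0, stepDecrease, slopeRatio,
    sqrt_one_sub_circleRadius_sq hx, sqrt_one_sub_circleRadius_sq hT]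
  have h1 := circleRadius_sq hx
  have h2 := circleRadius_sq hT
  rw [inner_drPoint] at h2 ⊢
  have h3 : ‖x - lam • e₂ hd‖ ^ 2 = ‖x‖ ^ 2 - 2 * lam * inner ℝ x (e₂ hd) + lam ^ 2 := by
    rw [norm_sub_sq_real, inner_smul_right, norm_smul, norm_e₂, Real.norm_eq_abs, mul_one, sq_abs]
    ring
  rw [h3]
  have ha : 0 < inner ℝ x (e₁ hd) := hx.1
  set s := circleRadius hd (drPoint hd lam x)
  set τ := circleRadius hd x
  set a := inner ℝ x (e₁ hd)
  set ρ := ‖x‖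
  have e : a * (s * (lam - s) / (a / ρ)) = ρ * (s * (lam - s)) := by field_simp
  have h4 : 2 / ρ * a ^ 2 = 2 * ρ * (1 - s ^ 2) := by
    rw [h2]
    field_simp
    ring
  rw [e, h1]
  linear_combination -h4 / 2

/-- The right-hand side is the distance from x to the axis ℝe₁. -/
lemma inner_e₂_le {hd : 2 ≤ d} (lam : ℝ) {x : E d} (hx : x ∈ slab hd) :
    inner ℝ x (e₂ hd) ≤ ‖x‖ * circleRadius hd (drPoint hd lam x) := by
  have hx0 := ne_zero_of_mem_halfSpace (slab_subset_halfSpace hd hx)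
  have hρ : 0 < ‖x‖ := norm_pos_iff.2 hx0
  have h2 := circleRadius_sq (drPoint_mem_slab hd lam (slab_subset_halfSpace hd hx))
  rw [inner_drPoint] at h2
  refine le_of_sq_le_sq ?_ (mul_nonneg hρ.le (circleRadius_nonneg _ _))
  rw [mul_pow, h2]
  have := sq_inner_add_sq_inner_le hd x
  have e : ‖x‖ ^ 2 * (1 - (inner ℝ x (e₁ hd) / ‖x‖) ^ 2) = ‖x‖ ^ 2 - inner ℝ x (e₁ hd) ^ 2 := by
    field_simp
  rw [e]
  linarith

/-- Benoist's function decreases along the Douglas-Rachford iteration. -/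
theorem F_drPoint_lt {hd : 2 ≤ d} {lam : ℝ} (hl0 : 0 ≤ lam) (hl1 : lam < 1) {x : E d}
    (hx : x ∈ slab hd) (hne : F hd lam x ≠ F hd lam (xStar hd lam)) :
    F hd lam (drPoint hd lam x) < F hd lam x := by
  have hT := drPoint_mem_slab hd lam (slab_subset_halfSpace hd hx)
  have h := F_sub_F_drPoint lam hx
  have h2 := inner_e₂_le lam hx
  by_cases hs : circleRadius hd (drPoint hd lam x) = lam ∧ circleRadius hd x = lam
  -- Equal first coordinates of x and Tx force ‖x‖ = 1. The decrease is then λ(λ - ⟨x, e₂⟩), which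
  -- is F(x) - F(x*).
  · have hx0 := ne_zero_of_mem_halfSpace (slab_subset_halfSpace hd hx)
    have hρ : 0 < ‖x‖ := norm_pos_iff.2 hx0
    have h3 := sqrt_one_sub_circleRadius_sq hT
    have h4 := sqrt_one_sub_circleRadius_sq hx
    rw [hs.1, inner_drPoint] at h3
    rw [hs.2] at h4
    rw [h4] at h3
    have ha : 0 < inner ℝ x (e₁ hd) := hx.1
    have hρ1 : ‖x‖ = 1 := by
      field_simp at h3
      linarith
    rw [hs.1, hs.2, stepDecrease_self lam hl0 hl1, hρ1] at h
    rw [hs.1, hρ1] at h2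
    have h5 : F hd lam x = (1 - 2 * lam * inner ℝ x (e₂ hd) + lam ^ 2) / 2 +
        radialPart lam lam := by
      rw [F_eq lam hx, hs.2, norm_sub_sq_real, inner_smul_right, norm_smul, norm_e₂,
        Real.norm_eq_abs, mul_one, sq_abs, hρ1]
      ring
    rw [F_xStar hd hl0 hl1, h5] at hne
    have h6 : lam * (1 * lam - inner ℝ x (e₂ hd)) ≠ 0 := fun h7 => hne (by linear_combination h7)
    have h7 : 0 ≤ lam * (1 * lam - inner ℝ x (e₂ hd)) := mul_nonneg hl0 (sub_nonneg.2 h2)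
    have h8 := lt_of_le_of_ne h7 h6.symm
    nlinarith
  · have h3 := stepDecrease_pos hl0 hl1 (circleRadius_nonneg hd (drPoint hd lam x))
      (circleRadius_lt_one hT) (circleRadius_nonneg hd x) (circleRadius_lt_one hx) hs
    have h4 := mul_nonneg hl0 (sub_nonneg.2 h2)
    linarith

lemma F_drPoint_le {hd : 2 ≤ d} {lam : ℝ} (hl0 : 0 ≤ lam) (hl1 : lam < 1) {x : E d}
    (hx : x ∈ slab hd) : F hd lam (drPoint hd lam x) ≤ F hd lam x := by
  have hT := drPoint_mem_slab hd lam (slab_subset_halfSpace hd hx)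
  have h := F_sub_F_drPoint lam hx
  have h2 := mul_nonneg hl0 (sub_nonneg.2 (inner_e₂_le lam hx))
  by_cases hs : circleRadius hd (drPoint hd lam x) = lam ∧ circleRadius hd x = lam
  · have h3 : stepDecrease lam lam lam = 0 := by simp [stepDecrease_self lam hl0 hl1]
    rw [hs.2] at h
    rw [hs.1] at h h2
    linarith
  · have h3 := stepDecrease_pos hl0 hl1 (circleRadius_nonneg hd (drPoint hd lam x))
      (circleRadius_lt_one hT) (circleRadius_nonneg hd x) (circleRadius_lt_one hx) hs
    linarith

/-! ### Continuity and compact sublevel sets -/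

lemma continuousOn_F (hd : 2 ≤ d) (lam : ℝ) : ContinuousOn (F hd lam) (slab hd) := by
  have h1 : ∀ x ∈ slab hd, (inner ℝ x (e₁ hd) : ℝ) ≠ 0 := fun x hx => hx.1.ne'
  have h2 : ∀ x ∈ slab hd, 1 + √(1 - (inner ℝ x (e₁ hd) : ℝ) ^ 2) ≠ 0 := fun x _ => by
    positivity
  unfold F
  fun_prop (disch := assumption)

/-- Since log(1 + s) ≤ s, the radial part dominates (λ - 1) log⟨x, e₁⟩ ≥ 0. A bound on F therefore
bounds x and keeps ⟨x, e₁⟩ away from 0, the open end of the slab. -/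
lemma isCompact_sublevel (hd : 2 ≤ d) {lam : ℝ} (hl0 : 0 ≤ lam) (hl1 : lam < 1) (c : ℝ) :
    IsCompact {x ∈ slab hd | F hd lam x ≤ c} := by
  set ε : ℝ := Real.exp (-c / (1 - lam)) with hε
  set D : Set (E d) := {x | inner ℝ x (e₁ hd) ∈ Set.Icc ε 1}
  have hlog : ∀ x ∈ slab hd, (lam - 1) * Real.log (inner ℝ x (e₁ hd)) ≤
      radialPart lam (circleRadius hd x) := fun x hx => by
    have h1 : 1 - circleRadius hd x ^ 2 = inner ℝ x (e₁ hd) ^ 2 := by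
      rw [circleRadius_sq hx]
      ring
    rw [radialPart, h1, Real.log_pow]
    have h2 := Real.log_le_sub_one_of_pos
      (by linarith [circleRadius_nonneg hd x] : 0 < 1 + circleRadius hd x)
    push_cast
    nlinarith
  have hpos : ∀ x ∈ slab hd, 0 ≤ (lam - 1) * Real.log (inner ℝ x (e₁ hd)) := fun x hx =>
    mul_nonneg_of_nonpos_of_nonpos (by linarith) (Real.log_nonpos hx.1.le hx.2)
  have hD : D ⊆ slab hd := fun x hx => ⟨(Real.exp_pos _).trans_le hx.1, hx.2⟩
  have hDc : IsClosed D := isClosed_Icc.preimage (by fun_prop : Continuous fun x : E d =>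
    (inner ℝ x (e₁ hd) : ℝ))
  have e : {x ∈ slab hd | F hd lam x ≤ c} = D ∩ F hd lam ⁻¹' Set.Iic c := by
    ext x
    refine ⟨fun ⟨hx, hc⟩ => ⟨⟨?_, hx.2⟩, hc⟩, fun ⟨hx, hc⟩ => ⟨hD hx, hc⟩⟩
    rw [hε, ← Real.le_log_iff_exp_le hx.1, div_le_iff₀ (by linarith)]
    have h1 := hlog x hx
    rw [F_eq lam hx] at hc
    nlinarith [sq_nonneg ‖x - lam • e₂ hd‖]
  refine Metric.isCompact_of_isClosed_isBounded ?_ ?_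
  · rw [e]
    exact ((continuousOn_F hd lam).mono hD).preimage_isClosed_of_isClosed hDc isClosed_Iic
  · refine (Metric.isBounded_closedBall (x := lam • e₂ hd) (r := √(2 * c))).subset ?_
    rintro x ⟨hx, hc⟩
    rw [Metric.mem_closedBall, dist_eq_norm]
    refine Real.le_sqrt_of_sq_le ?_
    have h1 := hlog x hx
    have h2 := hpos x hx
    rw [F_eq lam hx] at hc
    linarith

end Operator

/-! ### Robust stability from a continuous Lyapunov function -/

/-- A decrease `g` that is positive off the zeros of a function `f` with compact sublevel sets is
bounded below by a `1`-Lipschitz function of `f`. -/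
lemma exists_lipschitz_rate {X : Type*} [TopologicalSpace X] {A : Set X} {f g : X → ℝ}
    (hf : ContinuousOn f A) (hg : ContinuousOn g A)
    (hcomp : ∀ c, IsCompact {x ∈ A | f x ≤ c}) (hg0 : ∀ x ∈ A, 0 ≤ g x)
    (hpos : ∀ x ∈ A, f x ≠ 0 → 0 < g x) (hzero : ∃ x ∈ A, f x = 0 ∧ g x = 0) :
    ∃ α : ℝ → ℝ, LipschitzWith 1 α ∧ (∀ t, 0 ≤ α t) ∧ α 0 = 0 ∧ (∀ t, 0 < t → 0 < α t) ∧
      (∀ t, 0 ≤ t → α t ≤ t) ∧ ∀ x ∈ A, α (f x) ≤ g x := by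
  obtain ⟨x₀, hx₀, hfx₀, hgx₀⟩ := hzero
  set S : Set (ℝ × ℝ) := (fun x => (f x, g x)) '' A with hS
  have hmem : ((0 : ℝ), (0 : ℝ)) ∈ S := ⟨x₀, hx₀, by simp [hfx₀, hgx₀]⟩
  -- The distance from (t, 0) to the pairs (f x, g x) is 1-Lipschitz in t; comparison with the pairs
  -- (0, 0) and (f x, g x) gives the bounds by t and by g x.
  refine ⟨fun t => Metric.infDist (t, (0 : ℝ)) S, ?_, fun t => Metric.infDist_nonneg,
    Metric.infDist_zero_of_mem hmem, fun t ht => ?_, fun t ht => ?_, fun x hx => ?_⟩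
  · have h := (Metric.lipschitz_infDist_pt S).comp
      (LipschitzWith.prodMk_right (0 : ℝ) : LipschitzWith 1 fun t : ℝ => (t, (0 : ℝ)))
    rwa [one_mul] at h
  · refine (Metric.infDist_pos_iff_notMem_closure ⟨_, hmem⟩).1 fun hcl => ?_
    -- Near (t, 0) only pairs from the compact sublevel set at t + 1 matter, so a limit (t, 0) would
    -- be attained, contradicting g > 0 where f ≠ 0.
    set K : Set (ℝ × ℝ) := (fun x => (f x, g x)) '' {x ∈ A | f x ≤ t + 1} with hK
    have hKc : IsCompact K := (hcomp (t + 1)).image_of_continuousOn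
      ((hf.prodMk hg).mono fun x hx => hx.1)
    have hU : IsOpen {p : ℝ × ℝ | p.1 < t + 1} := isOpen_lt continuous_fst continuous_const
    have h1 : ((t, 0) : ℝ × ℝ) ∈ closure ({p : ℝ × ℝ | p.1 < t + 1} ∩ S) :=
      hU.inter_closure ⟨by simp, hcl⟩
    have h2 : {p : ℝ × ℝ | p.1 < t + 1} ∩ S ⊆ K := by
      rintro _ ⟨hp, x, hx, rfl⟩
      exact ⟨x, ⟨hx, le_of_lt hp⟩, rfl⟩
    have h3 : ((t, 0) : ℝ × ℝ) ∈ K := hKc.isClosed.closure_subset_iff.2 h2 h1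
    obtain ⟨x, ⟨hx, -⟩, hxe⟩ := h3
    have e1 : f x = t := congrArg Prod.fst hxe
    have e2 : g x = 0 := congrArg Prod.snd hxe
    exact (hpos x hx (by rw [e1]; exact ht.ne')).ne' e2
  · refine (Metric.infDist_le_dist_of_mem hmem).trans ?_
    simp [Prod.dist_eq, abs_of_nonneg ht, ht]
  · refine (Metric.infDist_le_dist_of_mem (Set.mem_image_of_mem _ hx)).trans ?_
    simp [Prod.dist_eq, Real.dist_eq, abs_of_nonneg (hg0 x hx), hg0 x hx]

section Stability

variable {d : ℕ}

lemma mem_zeroSet {D : Set (E d)} {T : E d → Set (E d)} {ω : E d → ℝ≥0} {x : E d} :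
    x ∈ zeroSet D T ω ↔ x ∈ D ∧ ∀ φ ∈ solutions T x, ∀ n, ω (φ n) = 0 := by
  simp only [zeroSet, Set.mem_ofPred_eq, ENNReal.iSup_eq_zero, ENNReal.coe_eq_zero]
  exact and_congr_right fun _ => ⟨fun h φ hφ n => h n φ hφ, fun h n φ hφ => h φ hφ n⟩

/-- If `V` is controlled along the solutions by `γ ∘ V`, then the zero set is that of `V`. -/
lemma zeroSet_eq {D : Set (E d)} {T : E d → Set (E d)} {V : E d → ℝ≥0} {γ : ℝ≥0 → ℝ≥0}
    (hγ : γ 0 = 0) (hne : ∀ x ∈ D, (T x).Nonempty) (hTD : ∀ x ∈ D, T x ⊆ D)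
    (hV : ∀ x ∈ D, ∀ y ∈ T x, V y ≤ γ (V x)) : zeroSet D T V = {x ∈ D | V x = 0} := by
  ext x
  rw [mem_zeroSet]
  refine and_congr_right fun hx => ⟨fun h => ?_, fun h φ hφ n => ?_⟩
  -- Without a solution starting at x the supremum would be vacuously 0; iterating a selection of T
  -- supplies one.
  · choose! t ht using hne
    have hD : ∀ n, t^[n] x ∈ D := fun n => by
      induction n with
      | zero => exact hx
      | succ n ih =>
        rw [Function.iterate_succ_apply']
        exact hTD _ ih (ht _ ih)
    have := h (fun n => t^[n] x) ⟨rfl, fun n => by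
      simp only [Function.iterate_succ_apply']
      exact ht _ (hD n)⟩ 0
    simpa using this
  · have : φ n ∈ D ∧ V (φ n) = 0 := by
      induction n with
      | zero =>
        rw [hφ.1]
        exact ⟨hx, h⟩
      | succ n ih =>
        refine ⟨hTD _ ih.1 (hφ.2 n), le_antisymm ?_ zero_le⟩
        have := hV _ ih.1 _ (hφ.2 n)
        rwa [ih.2, hγ] at this
    exact this.2

/-- A monotone comparison function below the identity gives `𝒦ℒ`-stability. -/
lemma isKLStable_of_le {D : Set (E d)} {T : E d → Set (E d)} {V : E d → ℝ≥0} {γ : ℝ≥0 → ℝ≥0}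
    (hγc : Continuous γ) (hγm : Monotone γ) (hγle : ∀ s, γ s ≤ s)
    (hγlt : ∀ s, γ s = s → s = 0) (hTD : ∀ x ∈ D, T x ⊆ D)
    (hV : ∀ x ∈ D, ∀ y ∈ T x, V y ≤ γ (V x)) : IsKLStable D T V V := by
  have hanti : ∀ s, Antitone fun n => γ^[n] s := fun s => antitone_nat_of_succ_le fun n => by
    rw [Function.iterate_succ_apply']
    exact hγle _
  have htend : ∀ s, Filter.Tendsto (fun n => γ^[n] s) Filter.atTop (nhds 0) := fun s => by
    have h := tendsto_atTop_ciInf (hanti s) (OrderBot.bddBelow _)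
    have h2 := isFixedPt_of_tendsto_iterate h hγc.continuousAt
    rwa [hγlt _ h2] at h
  -- The iterates alone are only monotone in s; the summand s·exp(-t) makes β strictly increasing.
  refine ⟨fun s t => γ^[⌊t⌋₊] s + s * Real.toNNReal (Real.exp (-t)), ⟨fun t => ?_, fun t => ?_,
    fun t => ?_, fun s => ?_, fun s => ?_⟩, fun x hx φ hφ n => ?_⟩
  · exact (hγc.iterate _).add (continuous_id.mul continuous_const)
  · refine ((hγm.iterate _).add_strictMono fun a b hab => ?_)
    have : 0 < Real.toNNReal (Real.exp (-t)) := Real.toNNReal_pos.2 (Real.exp_pos _)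
    exact mul_lt_mul_of_pos_right hab this
  · have : ∀ n, γ^[n] 0 = 0 := fun n =>
      Function.iterate_fixed (le_antisymm (hγle 0) zero_le) n
    simp [this]
  · intro a b hab
    refine add_le_add (hanti s (Nat.floor_mono hab)) (mul_le_mul_right ?_ s)
    exact Real.toNNReal_mono (Real.exp_le_exp.2 (neg_le_neg (NNReal.coe_le_coe.2 hab)))
  · have h1 := (htend s).comp (tendsto_nat_floor_atTop (α := ℝ≥0))
    have h2 : Filter.Tendsto (fun t : ℝ≥0 => Real.toNNReal (Real.exp (-(t : ℝ)))) Filter.atTop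
        (nhds 0) := by
      rw [← Real.toNNReal_zero]
      exact (continuous_real_toNNReal.tendsto 0).comp (Real.tendsto_exp_neg_atTop_nhds_zero.comp
        (NNReal.tendsto_coe_atTop.2 Filter.tendsto_id))
    simpa using h1.add (h2.const_mul s)
  · have : φ n ∈ D ∧ V (φ n) ≤ γ^[n] (V x) := by
      induction n with
      | zero =>
        rw [hφ.1]
        exact ⟨hx, le_rfl⟩
      | succ n ih =>
        refine ⟨hTD _ ih.1 (hφ.2 n), (hV _ ih.1 _ (hφ.2 n)).trans ?_⟩
        rw [Function.iterate_succ_apply']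
        exact hγm ih.2
    simpa using this.2.trans le_self_add

/-- For an open neighbourhood `U` of part of the diagonal there is a continuous radius,
positive on that part, such that balls of positive radius are contained in the slices of `U`. -/
lemma exists_radius {X : Type*} [PseudoMetricSpace X] {U : Set (X × X)} (hU : IsOpen U)
    (hne : Uᶜ.Nonempty) : ∃ σ : X → ℝ≥0, Continuous σ ∧ (∀ x, (x, x) ∈ U → 0 < σ x) ∧
      ∀ x z, 0 < σ x → dist z x ≤ σ x → (x, z) ∈ U := by
  -- Halving keeps the closed ball inside the slice. `Uᶜ` must be nonempty because `Metric.infDist`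
  -- to the empty set is 0.
  refine ⟨fun x => ⟨Metric.infDist (x, x) Uᶜ / 2, div_nonneg Metric.infDist_nonneg two_pos.le⟩,
    ?_, fun x hx => ?_, fun x z hx hz => ?_⟩
  · refine Continuous.subtype_mk ?_ _
    exact ((Metric.continuous_infDist_pt _).comp (continuous_id.prodMk continuous_id)).div_const 2
  · have := (hU.isClosed_compl.notMem_iff_infDist_pos hne).1 fun h : (x, x) ∈ Uᶜ => h hx
    exact NNReal.coe_pos.1 (half_pos this)
  · by_contra hc
    have h1 := Metric.infDist_le_dist_of_mem (x := (x, x)) (show (x, z) ∈ Uᶜ from hc)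
    have h2 : dist (x, x) (x, z) = dist z x := by
      rw [Prod.dist_eq, dist_self, dist_comm x z]
      exact max_eq_right dist_nonneg
    have hx' : 0 < Metric.infDist (x, x) Uᶜ / 2 := hx
    have hz' : dist z x ≤ Metric.infDist (x, x) Uᶜ / 2 := hz
    rw [h2] at h1
    linarith

/-- With a = α(V x), the radius is chosen so that a displacement raises V by at most a/4 and
applying t after it still leaves at most V x - 3a/4. Where V vanishes the radius may be 0, and the
ball is a point. -/
theorem isRobustlyKLStable_of_decrease {D : Set (E d)} (hD : IsOpen D) (hne : Dᶜ.Nonempty)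
    {T : E d → Set (E d)} {t : E d → E d} (hT : ∀ x ∈ D, T x = {t x}) (htD : Set.MapsTo t D D)
    (htc : ContinuousOn t D) {V : E d → ℝ≥0} (hV : ContinuousOn V D) {α : ℝ → ℝ}
    (hα : LipschitzWith 1 α) (hα0 : α 0 = 0) (hαpos : ∀ s, 0 < s → 0 < α s)
    (hαle : ∀ s, 0 ≤ s → α s ≤ s) (hdec : ∀ x ∈ D, (V (t x) : ℝ) ≤ V x - α (V x)) :
    zeroSet D T V = {x ∈ D | V x = 0} ∧ IsRobustlyKLStable D T V V := by
  have hαabs : ∀ a b, a ≤ b → α b - α a ≤ b - a ∧ α a - α b ≤ b - a := fun a b hab => by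
    have h := hα.dist_le_mul b a
    rw [Real.dist_eq, Real.dist_eq, NNReal.coe_one, one_mul, abs_of_nonneg (sub_nonneg.2 hab)] at h
    have := abs_le.1 h
    constructor <;> linarith
  have hαnn : ∀ s : ℝ≥0, 0 ≤ α s := fun s => by
    rcases eq_or_ne s 0 with rfl | h
    · simp [hα0]
    · exact (hαpos s (by positivity)).le
  -- As α is 1-Lipschitz, α(v - 3α(v)/4) ≤ 7α(v)/4. The outer displacement thus costs at most
  -- 7α(v)/16, and 3/4 - 7/16 = 5/16.
  obtain ⟨γ, hγ⟩ : ∃ γ : ℝ≥0 → ℝ≥0, ∀ s, (γ s : ℝ) = s - 5 / 16 * α s :=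
    ⟨fun s => ⟨s - 5 / 16 * α s, by linarith [hαle s s.2, hαnn s]⟩, fun s => rfl⟩
  have hγc : Continuous γ := by
    rw [NNReal.isEmbedding_coe.continuous_iff]
    have : ((↑) : ℝ≥0 → ℝ) ∘ γ = fun s : ℝ≥0 => (s : ℝ) - 5 / 16 * α s := funext hγ
    rw [this]
    exact NNReal.continuous_coe.sub ((hα.continuous.comp NNReal.continuous_coe).const_mul _)
  have hγm : Monotone γ := fun a b hab => by
    rw [← NNReal.coe_le_coe] at hab ⊢
    rw [hγ, hγ]
    linarith [(hαabs a b hab).1]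
  have hγle : ∀ s, γ s ≤ s := fun s => by
    rw [← NNReal.coe_le_coe, hγ]
    linarith [hαnn s]
  have hγlt : ∀ s, γ s = s → s = 0 := fun s hs => by
    by_contra h
    have h1 := hαpos s (by positivity)
    have h2 := hγ s
    rw [hs] at h2
    linarith
  have hγ0 : γ 0 = 0 := le_antisymm (hγle 0) zero_le
  have hVr : ContinuousOn (fun x => (V x : ℝ)) D := NNReal.continuous_coe.comp_continuousOn hV
  have hVα : ∀ c : ℝ, ContinuousOn (fun x => (V x : ℝ) + c * α (V x)) D := fun c =>
    hVr.add ((hα.continuous.comp_continuousOn hVr).const_mul c)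
  have hVt : ContinuousOn (fun x => (V (t x) : ℝ)) D := hVr.comp htc htD
  have hopen : ∀ f g : E d → ℝ, ContinuousOn f D → ContinuousOn g D →
      IsOpen ((D ×ˢ D) ∩ {p : E d × E d | f p.2 < g p.1}) := fun f g hf hg => by
    have h := ((hg.comp continuousOn_fst fun p hp => hp.1).sub
      (hf.comp continuousOn_snd fun p hp => hp.2) : ContinuousOn
        (fun p : E d × E d => g p.1 - f p.2) (D ×ˢ D)).isOpen_inter_preimage
        (hD.prod hD) (isOpen_Ioi (a := (0 : ℝ)))
    convert h using 2
    ext p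
    simp
  have hcompl : ∀ s : Set (E d × E d), ((D ×ˢ D) ∩ s)ᶜ.Nonempty := fun s => by
    obtain ⟨x, hx⟩ := hne
    exact ⟨(x, x), fun h => hx h.1.1⟩
  obtain ⟨σ₁, hσ₁c, hσ₁, hσ₁'⟩ := exists_radius (hopen _ _ hVr (hVα (1 / 4))) (hcompl _)
  obtain ⟨σ₂, hσ₂c, hσ₂, hσ₂'⟩ := exists_radius (hopen _ _ hVt (hVα (-(3 / 4)))) (hcompl _)
  have hσpos : ∀ x ∈ D, V x ≠ 0 → 0 < min (σ₁ x) (σ₂ x) := fun x hx hVx => by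
    have h := hαpos (V x) (by positivity)
    have h1 := hdec x hx
    refine lt_min (hσ₁ x ⟨⟨hx, hx⟩, ?_⟩) (hσ₂ x ⟨⟨hx, hx⟩, ?_⟩)
    · show (V x : ℝ) < V x + 1 / 4 * α (V x)
      linarith
    · show (V (t x) : ℝ) < V x + -(3 / 4) * α (V x)
      linarith
  have hσ : ∀ x ∈ D, ∀ z, dist z x ≤ (min (σ₁ x) (σ₂ x) : ℝ≥0) →
      z ∈ D ∧ (V z : ℝ) ≤ V x + 1 / 4 * α (V x) ∧
        (V (t z) : ℝ) ≤ V x - 3 / 4 * α (V x) := fun x hx z hz => by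
    rcases eq_or_lt_of_le (zero_le (a := min (σ₁ x) (σ₂ x))) with h | h
    · rw [← h] at hz
      have : z = x := dist_le_zero.1 hz
      subst this
      exact ⟨hx, by linarith [hαnn (V z)], by linarith [hαnn (V z), hdec z hx]⟩
    · obtain ⟨h1, h2⟩ := lt_min_iff.1 h
      have h3 := hσ₁' x z h1 (hz.trans (NNReal.coe_le_coe.2 (min_le_left _ _)))
      have h4 := hσ₂' x z h2 (hz.trans (NNReal.coe_le_coe.2 (min_le_right _ _)))
      refine ⟨h3.1.2, le_of_lt h3.2, ?_⟩
      have h5 : (V (t z) : ℝ) < V x + -(3 / 4) * α (V x) := h4.2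
      linarith
  have hmem : ∀ x ∈ D, ∀ z ∈ perturb T (fun x => min (σ₁ x) (σ₂ x)) x,
      z ∈ D ∧ V z ≤ γ (V x) := fun x hx z hz => by
    simp only [perturb, Set.mem_iUnion, Metric.mem_closedBall, exists_prop] at hz
    obtain ⟨x', hx', y, hy, hzy⟩ := hz
    obtain ⟨h1, -, h2⟩ := hσ x hx x' hx'
    rw [hT x' h1] at hy
    obtain rfl : y = t x' := hy
    obtain ⟨h3, h4, -⟩ := hσ _ (htD h1) z hzy
    refine ⟨h3, ?_⟩
    rw [← NNReal.coe_le_coe, hγ]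
    have h5 := (hαabs _ _ h2).2
    have h6 := hαabs (V x - 3 / 4 * α (V x)) (V x) (by linarith [hαnn (V x)])
    linarith [h6.2]
  have hperturb : ∀ x ∈ D, t x ∈ perturb T (fun x => min (σ₁ x) (σ₂ x)) x := fun x hx => by
    simp only [perturb, Set.mem_iUnion, exists_prop]
    exact ⟨x, Metric.mem_closedBall_self NNReal.zero_le_coe, t x, by rw [hT x hx]; rfl,
      Metric.mem_closedBall_self NNReal.zero_le_coe⟩
  have hzT : zeroSet D T V = {x ∈ D | V x = 0} := by
    refine zeroSet_eq hγ0 (fun x hx => ?_) (fun x hx y hy => ?_) fun x hx y hy =>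
      (hmem x hx y ?_).2
    · rw [hT x hx]
      exact Set.singleton_nonempty _
    · rw [hT x hx] at hy
      obtain rfl : y = t x := hy
      exact htD hx
    · rw [hT x hx] at hy
      obtain rfl : y = t x := hy
      exact hperturb x hx
  refine ⟨hzT, fun x => min (σ₁ x) (σ₂ x), (hσ₁c.min hσ₂c).continuousOn,
    fun x hx z hz => (hσ x hx z hz).1, fun x hx => ?_, ?_, ?_⟩
  · rw [hzT] at hx
    exact hσpos x hx.1 fun h => hx.2 ⟨hx.1, h⟩
  · rw [hzT]
    exact zeroSet_eq hγ0 (fun x hx => ⟨_, hperturb x hx⟩) (fun x hx z hz => (hmem x hx z hz).1)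
      fun x hx z hz => (hmem x hx z hz).2
  · exact isKLStable_of_le hγc hγm hγle hγlt (fun x hx z hz => (hmem x hx z hz).1)
      fun x hx z hz => (hmem x hx z hz).2

end Stability

lemma classKInfty_id : ClassKInfty id :=
  ⟨⟨continuous_id, strictMono_id, rfl⟩, Filter.tendsto_id⟩

end DouglasRachford

end

/-! ### Lyapunov property and robust stability -/

theorem theorem2p6 (d : ℕ) (hd : 2 ≤ d) (lam : ℝ) (hlam0 : 0 ≤ lam) (hlam1 : lam < 1) :
    ∃ V : DouglasRachford.E d → ℝ≥0,
      (∀ x ∈ DouglasRachford.halfSpace hd, ∃ y ∈ DouglasRachford.slab hd,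
        DouglasRachford.drOperator (DouglasRachford.sphere d) (DouglasRachford.line hd lam) x
            = {y} ∧
        (V x : ℝ) = DouglasRachford.F hd lam y
          - DouglasRachford.F hd lam (DouglasRachford.xStar hd lam)) ∧
      ContinuousOn V (DouglasRachford.halfSpace hd) ∧
      DouglasRachford.IsLyapunov (DouglasRachford.halfSpace hd)
        (DouglasRachford.drOperator (DouglasRachford.sphere d) (DouglasRachford.line hd lam))
        V V V ∧
      DouglasRachford.IsRobustlyKLStable (DouglasRachford.halfSpace hd)
        (DouglasRachford.drOperator (DouglasRachford.sphere d) (DouglasRachford.line hd lam))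
        V V := by
  open DouglasRachford in
  set F₀ := F hd lam (xStar hd lam)
  set t := drPoint hd lam
  have hT : ∀ x ∈ halfSpace hd, drOperator (sphere d) (line hd lam) x = {t x} := fun x hx =>
    drOperator_eq hd lam (ne_zero_of_mem_halfSpace hx)
  have hts : ∀ x ∈ halfSpace hd, t x ∈ slab hd := fun x hx => drPoint_mem_slab hd lam hx
  have htD : Set.MapsTo t (halfSpace hd) (halfSpace hd) := fun x hx =>
    slab_subset_halfSpace hd (hts x hx)
  have htc : ContinuousOn t (halfSpace hd) := continuousOn_drPoint hd lam
  have hFc := continuousOn_F hd lam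
  set V : E d → ℝ≥0 := fun x => Real.toNNReal (F hd lam (t x) - F₀)
  have hV : ∀ x ∈ halfSpace hd, (V x : ℝ) = F hd lam (t x) - F₀ := fun x hx =>
    Real.coe_toNNReal _ (sub_nonneg.2 (F_xStar_le hlam0 hlam1 (hts x hx)))
  have hVc : ContinuousOn V (halfSpace hd) :=
    continuous_real_toNNReal.comp_continuousOn ((hFc.comp htc hts).sub continuousOn_const)
  have hx₀ := xStar_mem_slab hd hlam0 hlam1
  obtain ⟨α, hα, hαnn, hα0, hαpos, hαle, hαdec⟩ := exists_lipschitz_rate (A := slab hd)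
    (f := fun x => F hd lam x - F₀) (g := fun x => F hd lam x - F hd lam (t x))
    (hFc.sub continuousOn_const)
    (hFc.sub (hFc.comp (htc.mono (slab_subset_halfSpace hd))
      fun x hx => hts x (slab_subset_halfSpace hd hx)))
    (fun c => by simpa only [sub_le_iff_le_add] using isCompact_sublevel hd hlam0 hlam1 (c + F₀))
    (fun x hx => sub_nonneg.2 (F_drPoint_le hlam0 hlam1 hx))
    (fun x hx h => sub_pos.2 (F_drPoint_lt hlam0 hlam1 hx (sub_ne_zero.1 h)))
    ⟨xStar hd lam, hx₀, sub_self _, sub_eq_zero.2 (le_antisymm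
      (F_xStar_le hlam0 hlam1 (hts _ (slab_subset_halfSpace hd hx₀)))
      (F_drPoint_le hlam0 hlam1 hx₀))⟩
  -- The rate is applied at t x, which lies in the slab, since V x is the excess of F at t x.
  have hdec : ∀ x ∈ halfSpace hd, (V (t x) : ℝ) ≤ V x - α (V x) := fun x hx => by
    have h := hαdec (t x) (hts x hx)
    rw [hV x hx, hV _ (htD hx)]
    linarith
  have hne : (halfSpace hd)ᶜ.Nonempty := ⟨0, fun h => ne_zero_of_mem_halfSpace h rfl⟩
  obtain ⟨hzero, hrob⟩ := isRobustlyKLStable_of_decrease (isOpen_halfSpace hd) hne hT htD htc hVc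
    hα hα0 hαpos hαle hdec
  refine ⟨V, fun x hx => ⟨t x, hts x hx, hT x hx, hV x hx⟩, hVc,
    ⟨⟨id, id, classKInfty_id, classKInfty_id, fun x _ => ⟨le_rfl, le_rfl⟩⟩,
      ⟨fun s => ⟨α s, hαnn s⟩, ?_, fun s => ?_, fun x hx y hy => ?_⟩, fun x hx => ?_⟩, hrob⟩
  · exact Continuous.subtype_mk (hα.continuous.comp NNReal.continuous_coe) _
  · refine ⟨fun h => ?_, fun h => ?_⟩
    · have h' : α s = 0 := congrArg NNReal.toReal h
      by_contra hs
      exact (hαpos s (by positivity)).ne' h'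
    · subst h
      exact NNReal.eq hα0
  · rw [hT x hx] at hy
    obtain rfl : y = t x := hy
    exact hdec x hx
  · rw [hzero]
    exact ⟨fun h => ⟨hx, h⟩, fun h => h.2⟩
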